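/- Let $N\ge 2$, let $\Delta=\{x_0,x_1,\dots,x_N\}$ with $x_0<x_1<\dots<x_N$ be a partition of $I=[x_0,x_N]$, and let $\alpha=(\alpha_1,\dots,\alpha_N)\in(-1,1)^N$. For $i=1,\dots,N$ let $L_i:I\to[x_{i-1},x_i]$ be the increasing affine bijection. If $g,b\in\mathcal C(I)$ satisfy $b\ne g$, $b(x_0)=g(x_0)$ and $b(x_N)=g(x_N)$, the $\alpha$-fractal function $g_{\Delta,b}^{\alpha}$ with germ $g$ and base $b$ is the function in $\mathcal C(I)$ whose graph is the attractor of the iterated function system on $I\times\mathbb R$ given by $$W_i(t,y)=\bigl(L_i(t),\ \alpha_i y+g(L_i(t))-\alpha_i b(t)\bigr),\qquad i=1,\dots,N .$$ For $n\ge 1$ let $B_n$ be the Bernstein operator on $\mathcal C(I)$, $$B_nf(t)=\sum_{k=0}^n f\Bigl(x_0+\tfrac kn(x_N-x_0)\Bigr)\binom nk\frac{(t-x_0)^k(x_N-t)^{n-k}}{(x_N-x_0)^n}.$$ Theorem. For every $f\in\mathcal C(I)$ there is a sequence of $\alpha$-fractal functions, all with the given partition $\Delta$ and the given scaling vector $\alpha$,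 that converges to $f$ uniformly on $I$ and whose graphs all have the same box dimension (in particular, the box dimension of each of these graphs exists). Moreover, if $f$ is not an affine function on $I$, then there is $n_0\ge 1$ such that the sequence can be taken to be $(p_n)_{\Delta,B_n(p_n)}^{\alpha}$, $n\ge n_0$, where $p_n=B_n f$. -/

import Mathlib

open Set Filter Topology
open scoped NNReal

noncomputable section

namespace AlphaFractal

/-- The interval `I = [x₀, x_N]` of a partition `x₀ < x₁ < ⋯ < x_N`. -/
def interval {N : ℕ} (x : Fin (N + 1) → ℝ) : Set ℝ := Icc (x 0) (x (Fin.last N))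

/-- The increasing affine homeomorphism of `[x₀, x_N]` onto the subinterval number `i`,
which is `[x_i, x_{i+1}]` when the subintervals are numbered from `0` to `N - 1`. -/
def affineMap {N : ℕ} (x : Fin (N + 1) → ℝ) (i : Fin N) (t : ℝ) : ℝ :=
  x i.castSucc + (x i.succ - x i.castSucc) / (x (Fin.last N) - x 0) * (t - x 0)

/-- The map `W_i (t, y) = (L_i t, α_i y + g (L_i t) - α_i b t)`
with germ `g`, base `b` and scaling vector `α`. -/
def ifsMap {N : ℕ} (x : Fin (N + 1) → ℝ) (α : Fin N → ℝ) (g b : ℝ → ℝ) (i : Fin N)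
    (p : ℝ × ℝ) : ℝ × ℝ :=
  (affineMap x i p.1, α i * p.2 + g (affineMap x i p.1) - α i * b p.1)

/-- `A` is an attractor of the iterated function system `W` on `X`. -/
def IsAttractor {ι E : Type*} [TopologicalSpace E] (X : Set E) (W : ι → E → E) (A : Set E) :
    Prop :=
  A ⊆ X ∧ A.Nonempty ∧ IsCompact A ∧ A = ⋃ i, W i '' A

/-- The graph of `h` over the interval of the partition. -/
def graph {N : ℕ} (x : Fin (N + 1) → ℝ) (h : ℝ → ℝ) : Set (ℝ × ℝ) :=
  (fun t => (t, h t)) '' interval x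

/-- Admissible pairs of a germ `g` and a base `b`: continuous on `I`, with the same values at the
end points of `I`, and different as functions on `I`. -/
structure IsAdmissible {N : ℕ} (x : Fin (N + 1) → ℝ) (g b : ℝ → ℝ) : Prop where
  continuousOn_germ : ContinuousOn g (interval x)
  continuousOn_base : ContinuousOn b (interval x)
  left_eq : b (x 0) = g (x 0)
  right_eq : b (x (Fin.last N)) = g (x (Fin.last N))
  ne : ¬ EqOn b g (interval x)

/-- `h` is the `α`-fractal function of the germ `g` with partition `x`, base `b` and scaling
vector `α`: a continuous function on `I` whose graph is the attractor of the iterated function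
system `(W_i)` on `I × ℝ`. -/
structure IsAlphaFractal {N : ℕ} (x : Fin (N + 1) → ℝ) (α : Fin N → ℝ) (g b h : ℝ → ℝ) :
    Prop where
  admissible : IsAdmissible x g b
  continuousOn : ContinuousOn h (interval x)
  isAttractor : IsAttractor (interval x ×ˢ univ) (ifsMap x α g b) (graph x h)

/-- The classical Bernstein operator `B_n` (for `n ≥ 1`) on the interval `[x₀, x_N]`. -/
def bernsteinOp {N : ℕ} (x : Fin (N + 1) → ℝ) (n : ℕ) (f : ℝ → ℝ) (t : ℝ) : ℝ :=
  ∑ k ∈ Finset.range (n + 1),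
    f (x 0 + (k : ℝ) / (n : ℝ) * (x (Fin.last N) - x 0)) * (n.choose k : ℝ) *
      ((t - x 0) ^ k * (x (Fin.last N) - t) ^ (n - k)) / (x (Fin.last N) - x 0) ^ n

/-- `f` agrees on the interval `I` with a polynomial function of degree at most one. -/
def IsAffineOnInterval {N : ℕ} (x : Fin (N + 1) → ℝ) (f : ℝ → ℝ) : Prop :=
  ∃ m c : ℝ, ∀ t ∈ interval x, f t = m * t + c

/-- The totally bounded set `A` has box dimension `d`: with `N_δ(A)` the least number of closed
balls of radius `δ` that cover `A`, the limit of `log N_δ(A) / (- log δ)` as `δ → 0+` exists and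
equals `d`. In `ℝ × ℝ`, whose metric is the maximum metric, these balls are the closed squares of
side length `2 δ`; the Euclidean metric gives the same dimension. -/
def HasBoxDim {E : Type*} [PseudoMetricSpace E] (A : Set E) (d : ℝ) : Prop :=
  A.Nonempty ∧ TotallyBounded A ∧
    Tendsto (fun δ : ℝ≥0 =>
      Real.log ((Metric.externalCoveringNumber δ A).toNat : ℝ) / (- Real.log (δ : ℝ)))
      (𝓝[>] 0) (𝓝 d)

end AlphaFractal

end

/-!
Write `a_i` for the contraction ratios of the maps `L_i` and `γ = ∑ |α_i|`. The point is that for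
polynomial germs and bases the box dimension of the graph of a fractal function depends only on
the partition and on `α` (`exists_alphaFractal_hasBoxDim`): it is `1` if `γ ≤ 1`, and `1 + s` with
`∑ |α_i| a_i ^ s = 1` if `γ > 1`. The Bernstein polynomials `B_n f` and their images under `B_n` are
such germs and bases. They are admissible as soon as `B_n f` is not a fixed point of `B_n`, and by a
maximum principle the fixed points are affine (`exists_isAdmissible_bernsteinOp`).

The fractal function `h` of `g` and `b` satisfies `h (L_i t) = α_i h t + q_i t` with Lipschitz `q_i`.
Hence the variation and the total oscillation of `h` at scale `δ` obey renewal inequalities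
`F δ = ∑ |α_i| F (δ / a_i) + O(1)` (`HasVariationAtScale.renewal`, `HasOscillationAtScale.renewal`).
The covering number of the graph is bounded below by the variation over `8 δ`, and above by the
oscillation over `δ` plus `O(1 / δ)`. This gives the upper bound for the dimension, and for `γ > 1`
it gives the lower bound `1 + s` provided that the variation at some scale exceeds the fixed point of
the renewal inequality (`HasVariationAtScale.exists_growth`).

It remains to see that for `γ > 1` the variation of `h` is unbounded (`exists_hasVariationAtScale`).
The function `v = h - b` satisfies `v ∘ L_i = α_i v + (g - b) ∘ L_i`. Multiplying by the sign of
`α_i` and adding up gives `γ v = ∑ sign α_i (v - (g - b)) ∘ L_i`. The operator on the right divided by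
`γ` contracts the total variation, so among functions of bounded variation `v` is determined up to
constants; but the equation has a polynomial solution modulo constants. If `h` had bounded variation,
then `v` and `u = h - g` would be polynomials with `u ∘ L_i = α_i v` for all `i`. Two maps `L_i` with
`α_i ≠ 0` would carry the roots of `v` onto those of `u`, in particular the least and the greatest
ones, and would therefore coincide.
-/

namespace AlphaFractal

/-! ### The affine maps of a partition -/

/-- The contraction ratio of `affineMap x i`. -/
noncomputable def ratio {N : ℕ} (x : Fin (N + 1) → ℝ) (i : Fin N) : ℝ :=
  (x i.succ - x i.castSucc) / (x (Fin.last N) - x 0)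

/-- The inverse of `affineMap x i`. -/
noncomputable def affineInv {N : ℕ} (x : Fin (N + 1) → ℝ) (i : Fin N) (t : ℝ) : ℝ :=
  x 0 + (t - x i.castSucc) / ratio x i

section Geometry

variable {N : ℕ} {x : Fin (N + 1) → ℝ}

lemma affineMap_sub (i : Fin N) (s t : ℝ) :
    affineMap x i t - affineMap x i s = ratio x i * (t - s) := by
  simp only [affineMap, ratio]; ring

lemma length_pos (hN : 2 ≤ N) (hx : StrictMono x) : 0 < x (Fin.last N) - x 0 := by
  have : (0 : Fin (N + 1)) < Fin.last N := by
    rw [Fin.lt_def]; simp; omega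
  exact sub_pos.2 (hx this)

lemma left_mem_interval (hN : 2 ≤ N) (hx : StrictMono x) : x 0 ∈ interval x :=
  ⟨le_rfl, by linarith [length_pos hN hx]⟩

lemma right_mem_interval (hN : 2 ≤ N) (hx : StrictMono x) : x (Fin.last N) ∈ interval x :=
  ⟨by linarith [length_pos hN hx], le_rfl⟩

lemma node_mem_interval (hx : StrictMono x) (i : Fin (N + 1)) : x i ∈ interval x :=
  ⟨hx.monotone (Fin.zero_le i), hx.monotone (Fin.le_last i)⟩

lemma ratio_pos (hN : 2 ≤ N) (hx : StrictMono x) (i : Fin N) : 0 < ratio x i :=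
  div_pos (sub_pos.2 (hx i.castSucc_lt_succ)) (length_pos hN hx)

lemma sum_ratio (hN : 2 ≤ N) (hx : StrictMono x) : ∑ i, ratio x i = 1 := by
  have h : ∑ i : Fin N, (x i.succ - x i.castSucc) = x (Fin.last N) - x 0 := by
    have h1 := Fin.sum_univ_succ x
    have h2 := Fin.sum_univ_castSucc x
    rw [Finset.sum_sub_distrib]
    linarith
  simp only [ratio]
  rw [← Finset.sum_div, h, div_self (length_pos hN hx).ne']

lemma ratio_lt_one (hN : 2 ≤ N) (hx : StrictMono x) (i : Fin N) : ratio x i < 1 := by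
  rw [← sum_ratio hN hx]
  obtain ⟨j, hj⟩ : ∃ j : Fin N, j ≠ i := by
    have : Nontrivial (Fin N) := Fin.nontrivial_iff_two_le.2 hN
    exact exists_ne i
  exact Finset.single_lt_sum hj (Finset.mem_univ _) (Finset.mem_univ _) (ratio_pos hN hx j)
    fun k _ _ => (ratio_pos hN hx k).le

lemma exists_ratio_le (hN : 2 ≤ N) (hx : StrictMono x) :
    ∃ ρ, 0 < ρ ∧ ρ < 1 ∧ ∀ i, ratio x i ≤ ρ := by
  have : Nonempty (Fin N) := ⟨⟨0, by omega⟩⟩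
  obtain ⟨i, hi⟩ := Finite.exists_max (ratio x)
  exact ⟨ratio x i, ratio_pos hN hx i, ratio_lt_one hN hx i, hi⟩

lemma exists_le_ratio (hN : 2 ≤ N) (hx : StrictMono x) :
    ∃ μ, 0 < μ ∧ μ < 1 ∧ ∀ i, μ ≤ ratio x i := by
  have : Nonempty (Fin N) := ⟨⟨0, by omega⟩⟩
  obtain ⟨i, hi⟩ := Finite.exists_min (ratio x)
  exact ⟨ratio x i, ratio_pos hN hx i, ratio_lt_one hN hx i, hi⟩

lemma affineMap_left (i : Fin N) : affineMap x i (x 0) = x i.castSucc := by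
  simp [affineMap]

lemma affineMap_right (hN : 2 ≤ N) (hx : StrictMono x) (i : Fin N) :
    affineMap x i (x (Fin.last N)) = x i.succ := by
  have := (length_pos hN hx).ne'
  simp only [affineMap]; field_simp; ring

lemma affineMap_strictMono (hN : 2 ≤ N) (hx : StrictMono x) (i : Fin N) :
    StrictMono (affineMap x i) := by
  intro s t hst
  have := mul_pos (ratio_pos hN hx i) (sub_pos.2 hst)
  rw [← affineMap_sub] at this
  linarith

lemma affineMap_mem_Icc (hN : 2 ≤ N) (hx : StrictMono x) (i : Fin N) {t : ℝ}
    (ht : t ∈ interval x) : affineMap x i t ∈ Icc (x i.castSucc) (x i.succ) := by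
  have hm := (affineMap_strictMono hN hx i).monotone
  rw [← affineMap_left (x := x) i, ← affineMap_right hN hx i]
  exact ⟨hm ht.1, hm ht.2⟩

lemma Icc_node_subset_interval (hx : StrictMono x) (i : Fin N) :
    Icc (x i.castSucc) (x i.succ) ⊆ interval x :=
  Icc_subset_Icc (node_mem_interval hx _).1 (node_mem_interval hx _).2

lemma affineMap_mem (hN : 2 ≤ N) (hx : StrictMono x) (i : Fin N) {t : ℝ}
    (ht : t ∈ interval x) : affineMap x i t ∈ interval x :=
  Icc_node_subset_interval hx i (affineMap_mem_Icc hN hx i ht)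

lemma affineMap_affineInv (hN : 2 ≤ N) (hx : StrictMono x) (i : Fin N) (t : ℝ) :
    affineMap x i (affineInv x i t) = t := by
  have := affineMap_sub (x := x) i (x 0) (affineInv x i t)
  rw [affineMap_left, affineInv, add_sub_cancel_left,
    mul_div_cancel₀ _ (ratio_pos hN hx i).ne'] at this
  rw [affineInv]
  linarith

lemma affineInv_mem (hN : 2 ≤ N) (hx : StrictMono x) (i : Fin N) {t : ℝ}
    (ht : t ∈ Icc (x i.castSucc) (x i.succ)) : affineInv x i t ∈ interval x := by
  have hm := affineMap_strictMono hN hx i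
  constructor
  · rw [← hm.le_iff_le, affineMap_affineInv hN hx, affineMap_left]; exact ht.1
  · rw [← hm.le_iff_le, affineMap_affineInv hN hx, affineMap_right hN hx]; exact ht.2

lemma exists_affineMap_eq_of_mem_Icc (hN : 2 ≤ N) (hx : StrictMono x) (i : Fin N) {t : ℝ}
    (ht : t ∈ Icc (x i.castSucc) (x i.succ)) : ∃ s ∈ interval x, affineMap x i s = t :=
  ⟨_, affineInv_mem hN hx i ht, affineMap_affineInv hN hx i t⟩

lemma exists_mem_Icc_node (hN : 2 ≤ N) (hx : StrictMono x) {t : ℝ} (ht : t ∈ interval x) :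
    ∃ i : Fin N, t ∈ Icc (x i.castSucc) (x i.succ) := by
  by_contra! H
  have : ∀ k : Fin (N + 1), x k ≤ t := by
    intro k
    induction k using Fin.induction with
    | zero => exact ht.1
    | succ i ih =>
      by_contra! h
      exact H i ⟨ih, h.le⟩
  have hl := this (Fin.last N)
  obtain ⟨M, rfl⟩ : ∃ M, N = M + 1 := ⟨N - 1, by omega⟩
  exact H (Fin.last M) ⟨this _, by rw [Fin.succ_last]; exact ht.2⟩

lemma exists_affineMap_eq (hN : 2 ≤ N) (hx : StrictMono x) {t : ℝ} (ht : t ∈ interval x) :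
    ∃ i, ∃ s ∈ interval x, affineMap x i s = t := by
  obtain ⟨i, hi⟩ := exists_mem_Icc_node hN hx ht
  exact ⟨i, exists_affineMap_eq_of_mem_Icc hN hx i hi⟩

lemma affineMap_le_affineMap (hN : 2 ≤ N) (hx : StrictMono x) {i j : Fin N} (hij : i < j)
    {s t : ℝ} (hs : s ∈ interval x) (ht : t ∈ interval x) :
    affineMap x i s ≤ affineMap x j t :=
  calc affineMap x i s ≤ x i.succ := (affineMap_mem_Icc hN hx i hs).2
    _ ≤ x j.castSucc := hx.monotone (Fin.le_def.2 (by simpa using Fin.lt_def.1 hij))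
    _ ≤ affineMap x j t := (affineMap_mem_Icc hN hx j ht).1

end Geometry

/-! ### Families of nonoverlapping intervals and variation at a given scale -/

/-- The intervals `[l j, r j]` lie in the interval of the partition, have length at least `δ` and
do not overlap: the half-open intervals `(l j, r j]` are pairwise disjoint. -/
structure IsNonOverlapping {N : ℕ} (x : Fin (N + 1) → ℝ) {κ : Type} (δ : ℝ) (l r : κ → ℝ) :
    Prop where
  left_mem : ∀ j, l j ∈ interval x
  right_mem : ∀ j, r j ∈ interval x
  add_le : ∀ j, l j + δ ≤ r j
  disjoint : Pairwise (Function.onFun Disjoint fun j => Ioc (l j) (r j))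

/-- Some finite family of nonoverlapping intervals of length at least `δ` sees variation at
least `B` of the function `h`. -/
def HasVariationAtScale {N : ℕ} (x : Fin (N + 1) → ℝ) (h : ℝ → ℝ) (δ B : ℝ) : Prop :=
  ∃ (κ : Type) (_ : Fintype κ) (l r : κ → ℝ), IsNonOverlapping x δ l r ∧
    B ≤ ∑ j, |h (r j) - h (l j)|

section Variation

variable {N : ℕ} {x : Fin (N + 1) → ℝ}

lemma IsNonOverlapping.mono {κ : Type} {δ δ' : ℝ} {l r : κ → ℝ}
    (H : IsNonOverlapping x δ l r) (hδ : δ' ≤ δ) : IsNonOverlapping x δ' l r :=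
  ⟨H.left_mem, H.right_mem, fun j => by linarith [H.add_le j], H.disjoint⟩

/-- The images of nonoverlapping families under the maps of the partition form together a
nonoverlapping family. -/
lemma IsNonOverlapping.sigma (hN : 2 ≤ N) (hx : StrictMono x) {κ : Fin N → Type} {δ : ℝ}
    {η : Fin N → ℝ} {l r : ∀ i, κ i → ℝ} (H : ∀ i, IsNonOverlapping x (η i) (l i) (r i))
    (hδ : ∀ i, δ ≤ ratio x i * η i) :
    IsNonOverlapping x δ (fun p : Σ i, κ i => affineMap x p.1 (l p.1 p.2))
      (fun p : Σ i, κ i => affineMap x p.1 (r p.1 p.2)) where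
  left_mem p := affineMap_mem hN hx _ ((H p.1).left_mem _)
  right_mem p := affineMap_mem hN hx _ ((H p.1).right_mem _)
  add_le p := by
    have h1 := affineMap_sub (x := x) p.1 (l p.1 p.2) (r p.1 p.2)
    have h2 := mul_le_mul_of_nonneg_left (le_sub_iff_add_le'.2 ((H p.1).add_le p.2))
      (ratio_pos hN hx p.1).le
    linarith [hδ p.1]
  disjoint := by
    rintro ⟨i, a⟩ ⟨j, b⟩ hab
    simp only [Function.onFun]
    rw [Ioc_disjoint_Ioc]
    rcases lt_trichotomy i j with hij | rfl | hij
    · exact (min_le_left _ _).trans ((affineMap_le_affineMap hN hx hij ((H i).right_mem a)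
        ((H j).left_mem b)).trans (le_max_right _ _))
    · have hne : a ≠ b := fun h => hab (by rw [h])
      have hd := (H i).disjoint hne
      simp only [Function.onFun] at hd
      rw [Ioc_disjoint_Ioc] at hd
      have hm := (affineMap_strictMono hN hx i).monotone
      simpa only [hm.map_min, hm.map_max] using hm hd
    · exact (min_le_right _ _).trans ((affineMap_le_affineMap hN hx hij ((H j).right_mem b)
        ((H i).left_mem a)).trans (le_max_left _ _))

/-- Pairwise disjoint half-open intervals inside `[a, b]` have total length at most `b - a`. -/
lemma sum_length_le_of_disjoint {κ : Type} (s : Finset κ) {l r : κ → ℝ} {a b : ℝ} (hab : a ≤ b)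
    (hle : ∀ j ∈ s, l j ≤ r j) (hsub : ∀ j ∈ s, Ioc (l j) (r j) ⊆ Icc a b)
    (hd : (s : Set κ).Pairwise (Function.onFun Disjoint fun j => Ioc (l j) (r j))) :
    ∑ j ∈ s, (r j - l j) ≤ b - a := by
  have h1 : MeasureTheory.volume (⋃ j ∈ s, Ioc (l j) (r j)) ≤ MeasureTheory.volume (Icc a b) :=
    MeasureTheory.measure_mono (iUnion₂_subset hsub)
  rw [MeasureTheory.measure_biUnion_finset hd fun _ _ => measurableSet_Ioc, Real.volume_Icc] at h1
  simp only [Real.volume_Ioc] at h1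
  rw [← ENNReal.ofReal_sum_of_nonneg fun j hj => sub_nonneg.2 (hle j hj)] at h1
  exact (ENNReal.ofReal_le_ofReal_iff (sub_nonneg.2 hab)).1 h1

lemma IsNonOverlapping.sum_length_le (hN : 2 ≤ N) (hx : StrictMono x) {κ : Type} [Fintype κ]
    {δ : ℝ} {l r : κ → ℝ} (hδ : 0 ≤ δ) (H : IsNonOverlapping x δ l r) :
    ∑ j, (r j - l j) ≤ x (Fin.last N) - x 0 :=
  sum_length_le_of_disjoint _ (by linarith [length_pos hN hx])
    (fun j _ => by linarith [H.add_le j])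
    (fun j _ => Ioc_subset_Icc_self.trans
      (Icc_subset_Icc (H.left_mem j).1 (H.right_mem j).2))
    (fun i _ j _ hij => H.disjoint hij)

lemma HasVariationAtScale.mono {h : ℝ → ℝ} {δ δ' B B' : ℝ} (H : HasVariationAtScale x h δ B)
    (hδ : δ' ≤ δ) (hB : B' ≤ B) : HasVariationAtScale x h δ' B' := by
  obtain ⟨κ, _, l, r, h1, h2⟩ := H
  exact ⟨κ, inferInstance, l, r, h1.mono hδ, hB.trans h2⟩

/-- Renewal inequality for the variation at a given scale. -/
lemma HasVariationAtScale.renewal (hN : 2 ≤ N) (hx : StrictMono x) {α : Fin N → ℝ} {h : ℝ → ℝ}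
    {q : Fin N → ℝ → ℝ} {C : ℝ} (hC : 0 ≤ C)
    (hfe : ∀ i, ∀ t ∈ interval x, h (affineMap x i t) = α i * h t + q i t)
    (hq : ∀ i, ∀ s ∈ interval x, ∀ t ∈ interval x, |q i t - q i s| ≤ C * |t - s|)
    {δ : ℝ} (hδ : 0 ≤ δ) {B : Fin N → ℝ}
    (H : ∀ i, HasVariationAtScale x h (δ / ratio x i) (B i)) :
    HasVariationAtScale x h δ
      (∑ i, |α i| * B i - N * (C * (x (Fin.last N) - x 0))) := by
  choose κ _ l r h1 h2 using H
  refine ⟨Σ i, κ i, inferInstance, _, _, IsNonOverlapping.sigma hN hx h1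
    (fun i => (mul_div_cancel₀ _ (ratio_pos hN hx i).ne').ge), ?_⟩
  rw [Fintype.sum_sigma]
  have key : ∀ i, |α i| * B i - C * (x (Fin.last N) - x 0) ≤
      ∑ j, |h (affineMap x i (r i j)) - h (affineMap x i (l i j))| := by
    intro i
    have h0 : 0 ≤ δ / ratio x i := div_nonneg hδ (ratio_pos hN hx i).le
    have hlen := (h1 i).sum_length_le hN hx h0
    calc |α i| * B i - C * (x (Fin.last N) - x 0)
        ≤ |α i| * ∑ j, |h (r i j) - h (l i j)| - C * ∑ j, (r i j - l i j) := by
          gcongr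
          exact h2 i
      _ = ∑ j, (|α i| * |h (r i j) - h (l i j)| - C * (r i j - l i j)) := by
          rw [Finset.mul_sum, Finset.mul_sum, ← Finset.sum_sub_distrib]
      _ ≤ _ := by
          refine Finset.sum_le_sum fun j _ => ?_
          rw [hfe i _ ((h1 i).right_mem j), hfe i _ ((h1 i).left_mem j)]
          have e := hq i _ ((h1 i).left_mem j) _ ((h1 i).right_mem j)
          rw [abs_of_nonneg (by linarith [(h1 i).add_le j] : 0 ≤ r i j - l i j)] at e
          rw [← abs_mul]
          have tri := abs_sub_abs_le_abs_sub (α i * (h (r i j) - h (l i j)))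
            (-(q i (r i j) - q i (l i j)))
          rw [abs_neg] at tri
          have : α i * (h (r i j) - h (l i j)) - -(q i (r i j) - q i (l i j)) =
            α i * h (r i j) + q i (r i j) - (α i * h (l i j) + q i (l i j)) := by ring
          rw [this] at tri
          linarith
  calc ∑ i, |α i| * B i - N * (C * (x (Fin.last N) - x 0))
      = ∑ i, (|α i| * B i - C * (x (Fin.last N) - x 0)) := by
        rw [Finset.sum_sub_distrib]; simp
    _ ≤ _ := Finset.sum_le_sum fun i _ => key i

/-- A property that holds at the scales in `[δ₁, D]` and passes below `δ₁` from the scales `δ / a_i`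
to the scale `δ` holds at all scales up to `D`. -/
lemma scale_induction (hN : 2 ≤ N) (hx : StrictMono x) {p : ℝ → Prop} {δ₁ D : ℝ} (hδ₁ : 0 < δ₁)
    (hD : ∀ i, δ₁ / ratio x i ≤ D)
    (base : ∀ δ, δ₁ ≤ δ → δ ≤ D → p δ)
    (step : ∀ δ, 0 < δ → δ < δ₁ → (∀ i, p (δ / ratio x i)) → p δ) {δ : ℝ} (hδ : 0 < δ)
    (hδD : δ ≤ D) : p δ := by
  obtain ⟨ρ, hρ0, hρ1, hρ⟩ := exists_ratio_le hN hx
  have main : ∀ k : ℕ, ∀ δ, 0 < δ → δ ≤ D → δ₁ * ρ ^ k ≤ δ → p δ := by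
    intro k
    induction k with
    | zero => intro δ _ h2 h3; exact base δ (by simpa using h3) h2
    | succ k ih =>
      intro δ h1 h2 h3
      rcases le_or_gt δ₁ δ with h | h
      · exact base δ h h2
      refine step δ h1 h fun i => ih _ (div_pos h1 (ratio_pos hN hx i)) ?_ ?_
      · exact (div_le_div_of_nonneg_right h.le (ratio_pos hN hx i).le).trans (hD i)
      · rw [le_div_iff₀ (ratio_pos hN hx i)]
        calc δ₁ * ρ ^ k * ratio x i ≤ δ₁ * ρ ^ k * ρ := by gcongr; exact hρ i
          _ = δ₁ * ρ ^ (k + 1) := by ring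
          _ ≤ δ := h3
  obtain ⟨k, hk⟩ := exists_pow_lt_of_lt_one (div_pos hδ hδ₁) hρ1
  refine main k δ hδ hδD ?_
  rw [lt_div_iff₀ hδ₁] at hk
  linarith

lemma div_ratio_rpow_neg (hN : 2 ≤ N) (hx : StrictMono x) (i : Fin N) {δ s : ℝ} (hδ : 0 < δ) :
    (δ / ratio x i) ^ (-s) = ratio x i ^ s * δ ^ (-s) := by
  rw [Real.div_rpow hδ.le (ratio_pos hN hx i).le, Real.rpow_neg (ratio_pos hN hx i).le,
    div_inv_eq_mul, mul_comm]

/-- Once the variation at some scale exceeds the fixed point of the renewal inequality,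
it grows like `δ ^ (-s)` as `δ` decreases. -/
lemma HasVariationAtScale.exists_growth (hN : 2 ≤ N) (hx : StrictMono x) {α : Fin N → ℝ}
    {h : ℝ → ℝ} {q : Fin N → ℝ → ℝ} {C : ℝ} (hC : 0 ≤ C)
    (hfe : ∀ i, ∀ t ∈ interval x, h (affineMap x i t) = α i * h t + q i t)
    (hq : ∀ i, ∀ s ∈ interval x, ∀ t ∈ interval x, |q i t - q i s| ≤ C * |t - s|)
    (hγ : 1 < ∑ i, |α i|) {s : ℝ} (hs0 : 0 ≤ s) (hs : ∑ i, |α i| * ratio x i ^ s = 1)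
    {δ₀ B₀ : ℝ} (hδ₀ : 0 < δ₀)
    (hB₀ : N * (C * (x (Fin.last N) - x 0)) / (∑ i, |α i| - 1) < B₀)
    (H : HasVariationAtScale x h δ₀ B₀) :
    ∃ c, 0 < c ∧ ∀ δ, 0 < δ → δ ≤ δ₀ → HasVariationAtScale x h δ (c * δ ^ (-s)) := by
  obtain ⟨μ, hμ0, hμ1, hμ⟩ := exists_le_ratio hN hx
  set E := N * (C * (x (Fin.last N) - x 0)) with hE
  set γ := ∑ i, |α i| with hγdef
  set K := E / (γ - 1) with hK
  have hγ1 : 0 < γ - 1 := by linarith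
  have hE0 : 0 ≤ E := by
    have := length_pos hN hx
    positivity
  have hK0 : 0 ≤ K := by positivity
  have hKE : γ * K - E = K := by rw [hK]; field_simp; ring
  -- `c * δ ^ (-s) + K` reproduces itself under the renewal inequality, `K` being its fixed point;
  -- `c` is chosen so that it is at most `B₀` on the base range `[μ * δ₀, δ₀]`.
  set c := (B₀ - K) * (μ * δ₀) ^ s with hc
  have hcpos : 0 < c := mul_pos (by linarith) (Real.rpow_pos_of_pos (by positivity) _)
  have main : ∀ δ, 0 < δ → δ ≤ δ₀ → HasVariationAtScale x h δ (c * δ ^ (-s) + K) := by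
    intro δ h1 h2
    refine scale_induction (p := fun δ => HasVariationAtScale x h δ (c * δ ^ (-s) + K))
      hN hx (δ₁ := μ * δ₀) (D := δ₀) (by positivity) ?_ ?_ ?_ h1 h2
    · intro i
      rw [div_le_iff₀ (ratio_pos hN hx i), mul_comm]
      gcongr
      exact hμ i
    · intro δ h3 h4
      refine H.mono h4 ?_
      have h5 : δ ^ (-s) ≤ (μ * δ₀) ^ (-s) :=
        Real.rpow_le_rpow_of_nonpos (by positivity) h3 (by linarith)
      have h6 : c * (μ * δ₀) ^ (-s) = B₀ - K := by
        rw [hc, mul_assoc, ← Real.rpow_add (by positivity)]; simp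
      have := mul_le_mul_of_nonneg_left h5 hcpos.le
      linarith
    · intro δ h3 _ h5
      refine (HasVariationAtScale.renewal hN hx hC hfe hq h3.le h5).mono le_rfl ?_
      simp only [div_ratio_rpow_neg hN hx _ h3]
      have : ∑ i, |α i| * (c * (ratio x i ^ s * δ ^ (-s)) + K) =
          c * δ ^ (-s) * ∑ i, |α i| * ratio x i ^ s + γ * K := by
        rw [hγdef, Finset.mul_sum, Finset.sum_mul, ← Finset.sum_add_distrib]
        exact Finset.sum_congr rfl fun i _ => by ring
      rw [this, hs]
      linarith
  exact ⟨c, hcpos, fun δ h1 h2 => (main δ h1 h2).mono le_rfl (by linarith)⟩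

end Variation

/-! ### Fine covers and oscillation -/

/-- The intervals `[l j, r j]` cover the interval of the partition, have total length at most its
length, and have individual lengths between `μ * δ` and `δ`; the function `h` oscillates by at
most `o j` on `[l j, r j]`. -/
structure IsFineCover {N : ℕ} (x : Fin (N + 1) → ℝ) (h : ℝ → ℝ) {κ : Type} [Fintype κ]
    (μ δ : ℝ) (l r o : κ → ℝ) : Prop where
  left_mem : ∀ j, l j ∈ interval x
  right_mem : ∀ j, r j ∈ interval x
  le_length : ∀ j, μ * δ ≤ r j - l j
  length_le : ∀ j, r j - l j ≤ δ
  sum_le : ∑ j, (r j - l j) ≤ x (Fin.last N) - x 0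
  cover : ∀ t ∈ interval x, ∃ j, t ∈ Icc (l j) (r j)
  osc_le : ∀ j, ∀ s ∈ Icc (l j) (r j), ∀ t ∈ Icc (l j) (r j), |h t - h s| ≤ o j

/-- The function `h` has total oscillation at most `B` along some finite cover of the interval of
the partition by intervals of length comparable to `δ`. -/
def HasOscillationAtScale {N : ℕ} (x : Fin (N + 1) → ℝ) (h : ℝ → ℝ) (μ δ B : ℝ) : Prop :=
  ∃ (κ : Type) (_ : Fintype κ) (l r o : κ → ℝ), IsFineCover x h μ δ l r o ∧ ∑ j, o j ≤ B

section Oscillation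

variable {N : ℕ} {x : Fin (N + 1) → ℝ}

/-- Renewal inequality for the total oscillation at a given scale. -/
lemma HasOscillationAtScale.renewal (hN : 2 ≤ N) (hx : StrictMono x) {α : Fin N → ℝ} {h : ℝ → ℝ}
    {q : Fin N → ℝ → ℝ} {C : ℝ} (hC : 0 ≤ C)
    (hfe : ∀ i, ∀ t ∈ interval x, h (affineMap x i t) = α i * h t + q i t)
    (hq : ∀ i, ∀ s ∈ interval x, ∀ t ∈ interval x, |q i t - q i s| ≤ C * |t - s|)
    {μ δ : ℝ} {B : Fin N → ℝ}
    (H : ∀ i, HasOscillationAtScale x h μ (δ / ratio x i) (B i)) :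
    HasOscillationAtScale x h μ δ
      (∑ i, |α i| * B i + N * (C * (x (Fin.last N) - x 0))) := by
  choose κ _ l r o h1 h2 using H
  have hr := ratio_pos hN hx
  refine ⟨Σ i, κ i, inferInstance, fun p => affineMap x p.1 (l p.1 p.2),
    fun p => affineMap x p.1 (r p.1 p.2),
    fun p => |α p.1| * o p.1 p.2 + C * (r p.1 p.2 - l p.1 p.2), ?_, ?_⟩
  · refine ⟨fun p => affineMap_mem hN hx _ ((h1 p.1).left_mem _),
      fun p => affineMap_mem hN hx _ ((h1 p.1).right_mem _), ?_, ?_, ?_, ?_, ?_⟩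
    · intro p
      rw [affineMap_sub]
      have := mul_le_mul_of_nonneg_left ((h1 p.1).le_length p.2) (hr p.1).le
      rwa [mul_left_comm, mul_div_cancel₀ _ (hr p.1).ne'] at this
    · intro p
      rw [affineMap_sub]
      have := mul_le_mul_of_nonneg_left ((h1 p.1).length_le p.2) (hr p.1).le
      rwa [mul_div_cancel₀ _ (hr p.1).ne'] at this
    · simp only [affineMap_sub]
      rw [Fintype.sum_sigma]
      calc ∑ i, ∑ j, ratio x i * (r i j - l i j)
          = ∑ i, ratio x i * ∑ j, (r i j - l i j) := by simp only [Finset.mul_sum]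
        _ ≤ ∑ i, ratio x i * (x (Fin.last N) - x 0) :=
          Finset.sum_le_sum fun i _ => mul_le_mul_of_nonneg_left (h1 i).sum_le (hr i).le
        _ = x (Fin.last N) - x 0 := by rw [← Finset.sum_mul, sum_ratio hN hx, one_mul]
    · intro t ht
      obtain ⟨i, s, hs, rfl⟩ := exists_affineMap_eq hN hx ht
      obtain ⟨j, hj⟩ := (h1 i).cover s hs
      have hm := (affineMap_strictMono hN hx i).monotone
      exact ⟨⟨i, j⟩, hm hj.1, hm hj.2⟩
    · rintro ⟨i, j⟩ s hs t ht
      have hm := affineMap_strictMono hN hx i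
      have pre : ∀ s ∈ Icc (affineMap x i (l i j)) (affineMap x i (r i j)),
          ∃ s' ∈ Icc (l i j) (r i j), affineMap x i s' = s := by
        intro s hs
        obtain ⟨s', _, rfl⟩ := exists_affineMap_eq_of_mem_Icc hN hx i
          ⟨(affineMap_mem_Icc hN hx i ((h1 i).left_mem j)).1.trans hs.1,
            hs.2.trans (affineMap_mem_Icc hN hx i ((h1 i).right_mem j)).2⟩
        exact ⟨s', ⟨hm.le_iff_le.1 hs.1, hm.le_iff_le.1 hs.2⟩, rfl⟩
      obtain ⟨s', hs', rfl⟩ := pre s hs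
      obtain ⟨t', ht', rfl⟩ := pre t ht
      have hsub : Icc (l i j) (r i j) ⊆ interval x :=
        Icc_subset_Icc ((h1 i).left_mem j).1 ((h1 i).right_mem j).2
      rw [hfe i _ (hsub hs'), hfe i _ (hsub ht')]
      have e1 := hq i _ (hsub hs') _ (hsub ht')
      have e2 := mul_le_mul_of_nonneg_left ((h1 i).osc_le j _ hs' _ ht') (abs_nonneg (α i))
      have e3 : |t' - s'| ≤ r i j - l i j := by
        rw [abs_le]; constructor <;> linarith [hs'.1, hs'.2, ht'.1, ht'.2]
      have e4 := mul_le_mul_of_nonneg_left e3 hC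
      calc |α i * h t' + q i t' - (α i * h s' + q i s')|
          = |α i * (h t' - h s') + (q i t' - q i s')| := by ring_nf
        _ ≤ |α i| * |h t' - h s'| + |q i t' - q i s'| := by
          rw [← abs_mul]; exact abs_add_le _ _
        _ ≤ _ := by linarith
  · rw [Fintype.sum_sigma]
    calc ∑ i, ∑ j, (|α i| * o i j + C * (r i j - l i j))
        = ∑ i, (|α i| * ∑ j, o i j + C * ∑ j, (r i j - l i j)) := by
          refine Finset.sum_congr rfl fun i _ => ?_
          rw [Finset.sum_add_distrib, Finset.mul_sum, Finset.mul_sum]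
      _ ≤ ∑ i, (|α i| * B i + C * (x (Fin.last N) - x 0)) := by
          refine Finset.sum_le_sum fun i _ => ?_
          exact add_le_add (mul_le_mul_of_nonneg_left (h2 i) (abs_nonneg _))
            (mul_le_mul_of_nonneg_left (h1 i).sum_le hC)
      _ = _ := by rw [Finset.sum_add_distrib]; simp

/-- If `∑ |α_i| a_i ^ s < 1`, the total oscillation at scale `δ` is at most of order
`δ ^ (-s)`. -/
lemma exists_hasOscillationAtScale (hN : 2 ≤ N) (hx : StrictMono x) {α : Fin N → ℝ}
    {h : ℝ → ℝ} {q : Fin N → ℝ → ℝ} {C M : ℝ} (hC : 0 ≤ C)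
    (hfe : ∀ i, ∀ t ∈ interval x, h (affineMap x i t) = α i * h t + q i t)
    (hq : ∀ i, ∀ s ∈ interval x, ∀ t ∈ interval x, |q i t - q i s| ≤ C * |t - s|)
    (hM : ∀ s ∈ interval x, ∀ t ∈ interval x, |h t - h s| ≤ M)
    {s : ℝ} (hs0 : 0 ≤ s) (hs : ∑ i, |α i| * ratio x i ^ s < 1) :
    ∃ μ c, 0 < μ ∧ 0 < c ∧ ∀ δ, 0 < δ → δ ≤ x (Fin.last N) - x 0 →
      HasOscillationAtScale x h μ δ (c * δ ^ (-s)) := by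
  obtain ⟨μ, hμ0, hμ1, hμ⟩ := exists_le_ratio hN hx
  set ℓ := x (Fin.last N) - x 0 with hℓ
  have hℓ0 : 0 < ℓ := length_pos hN hx
  set θ := ∑ i, |α i| * ratio x i ^ s with hθ
  have hM0 : 0 ≤ M := (abs_nonneg _).trans
    (hM _ (left_mem_interval hN hx) _ (left_mem_interval hN hx))
  -- `c` dominates the base range `[ℓ, ℓ / μ]` and absorbs the error of the renewal inequality.
  set c := M * (ℓ / μ) ^ s + N * (C * ℓ) * ℓ ^ s / (1 - θ) + 1 with hc
  have hθ1 : 0 < 1 - θ := by linarith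
  have t1 : 0 ≤ M * (ℓ / μ) ^ s := by positivity
  have t2 : 0 ≤ N * (C * ℓ) * ℓ ^ s / (1 - θ) := by positivity
  have hc0 : 0 < c := by linarith
  refine ⟨μ, c, hμ0, hc0, fun δ h1 h2 => ?_⟩
  refine scale_induction (p := fun δ => HasOscillationAtScale x h μ δ (c * δ ^ (-s)))
      hN hx (δ₁ := ℓ) (D := ℓ / μ) hℓ0 ?_ ?_ ?_ h1 ?_
  · intro i
    have := hμ i
    gcongr
  · intro δ h3 h4
    have hδ : 0 < δ := hℓ0.trans_le h3
    refine ⟨Unit, inferInstance, fun _ => x 0, fun _ => x (Fin.last N), fun _ => M,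
      ⟨fun _ => left_mem_interval hN hx, fun _ => right_mem_interval hN hx, fun _ => ?_,
        fun _ => h3, by simp, fun t ht => ⟨(), ht⟩, fun _ => hM⟩, ?_⟩
    · rw [le_div_iff₀ hμ0] at h4; linarith
    · simp only [Finset.univ_unique, Finset.sum_const, Finset.card_singleton, one_smul]
      have h5 : (ℓ / μ) ^ (-s) ≤ δ ^ (-s) :=
        Real.rpow_le_rpow_of_nonpos hδ h4 (by linarith)
      calc M = M * (ℓ / μ) ^ s * (ℓ / μ) ^ (-s) := by
            rw [mul_assoc, ← Real.rpow_add (by positivity)]; simp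
        _ ≤ c * δ ^ (-s) := by gcongr; linarith
  · intro δ h3 h4 h5
    obtain ⟨κ, i, l, r, o, h6, h7⟩ := HasOscillationAtScale.renewal hN hx hC hfe hq h5
    refine ⟨κ, i, l, r, o, h6, h7.trans ?_⟩
    simp only [div_ratio_rpow_neg hN hx _ h3]
    have e1 : ∑ i, |α i| * (c * (ratio x i ^ s * δ ^ (-s))) = θ * (c * δ ^ (-s)) := by
      rw [hθ, Finset.sum_mul]
      exact Finset.sum_congr rfl fun i _ => by ring
    have e2 : ℓ ^ (-s) ≤ δ ^ (-s) := Real.rpow_le_rpow_of_nonpos h3 h4.le (by linarith)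
    have e3 : N * (C * ℓ) ≤ (1 - θ) * (c * δ ^ (-s)) := by
      calc N * (C * ℓ) = (1 - θ) * (N * (C * ℓ) * ℓ ^ s / (1 - θ) * ℓ ^ (-s)) := by
            rw [Real.rpow_neg hℓ0.le]
            have := (Real.rpow_pos_of_pos hℓ0 s).ne'
            field_simp
        _ ≤ (1 - θ) * (c * δ ^ (-s)) := by gcongr; linarith
    rw [e1]
    linarith
  · rw [le_div_iff₀ hμ0]
    nlinarith

/-! ### Covering numbers of graphs -/

/-- A cover of the graph by squares, one stack of squares over each interval of a fine cover. -/
lemma HasOscillationAtScale.exists_isCover {h : ℝ → ℝ} {μ B : ℝ} {δ : ℝ≥0} (hμ : 0 < μ)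
    (hδ : 0 < δ) (H : HasOscillationAtScale x h μ δ B) :
    ∃ F : Finset (ℝ × ℝ), Metric.IsCover δ (graph x h) (F : Set (ℝ × ℝ)) ∧
      (F.card : ℝ) ≤ B / δ + 3 * ((x (Fin.last N) - x 0) / (μ * δ)) := by
  classical
  obtain ⟨κ, _, l, r, o, h1, h2⟩ := H
  have hδ' : (0 : ℝ) < δ := hδ
  have hlr : ∀ j, l j ≤ r j := fun j => by
    have := h1.le_length j
    have : 0 < μ * (δ : ℝ) := by positivity
    linarith
  have ho : ∀ j, 0 ≤ o j := fun j =>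
    (abs_nonneg _).trans (h1.osc_le j _ (left_mem_Icc.2 (hlr j)) _ (left_mem_Icc.2 (hlr j)))
  let m : κ → ℕ := fun j => ⌈o j / (2 * δ)⌉₊
  refine ⟨Finset.univ.biUnion fun j => (Finset.Icc (-(m j : ℤ)) (m j)).image
    fun k : ℤ => (l j, h (l j) + 2 * δ * k + δ), ?_, ?_⟩
  · rw [Metric.isCover_iff_subset_iUnion_closedBall]
    rintro _ ⟨t, ht, rfl⟩
    obtain ⟨j, hj⟩ := h1.cover t ht
    set y := (h t - h (l j)) / (2 * δ) with hy
    have hosc := abs_le.1 (h1.osc_le j _ (left_mem_Icc.2 (hlr j)) _ hj)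
    have hm : o j / (2 * δ) ≤ m j := Nat.le_ceil _
    have hy1 : y ≤ m j := le_trans (by rw [hy]; gcongr; exact hosc.2) hm
    have hy2 : -(m j : ℝ) ≤ y := by
      have : -(o j) / (2 * δ) ≤ y := by rw [hy]; gcongr; exact hosc.1
      rw [neg_div] at this
      linarith
    have hyδ : y * (2 * δ) = h t - h (l j) := by rw [hy]; field_simp
    have f1 := Int.floor_le y
    have f2 := Int.lt_floor_add_one y
    simp only [mem_iUnion, Finset.coe_biUnion, Finset.coe_univ, mem_univ, iUnion_true]
    refine ⟨(l j, h (l j) + 2 * δ * ⌊y⌋ + δ), ⟨j, ?_⟩, ?_⟩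
    · rw [Finset.mem_coe, Finset.mem_image]
      refine ⟨⌊y⌋, Finset.mem_Icc.2 ⟨Int.le_floor.2 (by push_cast; exact hy2), ?_⟩, rfl⟩
      exact_mod_cast f1.trans hy1
    · rw [Metric.mem_closedBall, Prod.dist_eq, max_le_iff, Real.dist_eq, Real.dist_eq]
      constructor
      · rw [abs_le]
        constructor <;> linarith [hj.1, hj.2, h1.length_le j]
      · rw [abs_le]
        constructor <;> nlinarith
  · have hcard : ∀ j, (((Finset.Icc (-(m j : ℤ)) (m j)).image
        fun k : ℤ => (l j, h (l j) + 2 * δ * k + δ)).card : ℝ) ≤ o j / δ + 3 := by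
      intro j
      have c1 : (((Finset.Icc (-(m j : ℤ)) (m j)).image
        fun k : ℤ => (l j, h (l j) + 2 * δ * k + δ)).card : ℝ) ≤ 2 * m j + 1 := by
        refine (Nat.cast_le.2 Finset.card_image_le).trans ?_
        rw [Int.card_Icc]
        have : ((m j : ℤ) + 1 - -(m j : ℤ)).toNat = 2 * m j + 1 := by omega
        rw [this]; push_cast; exact le_rfl
      have c2 : (m j : ℝ) < o j / (2 * δ) + 1 :=
        Nat.ceil_lt_add_one (div_nonneg (ho j) (by positivity))
      have c3 : o j / (2 * δ) * 2 = o j / δ := by field_simp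
      linarith
    have hκ : (Fintype.card κ : ℝ) * (μ * δ) ≤ x (Fin.last N) - x 0 := by
      refine le_trans ?_ h1.sum_le
      have := Finset.sum_le_sum fun j (_ : j ∈ Finset.univ) => h1.le_length j
      simpa using this
    rw [← le_div_iff₀ (by positivity)] at hκ
    calc ((Finset.univ.biUnion fun j => (Finset.Icc (-(m j : ℤ)) (m j)).image
          fun k : ℤ => (l j, h (l j) + 2 * δ * k + δ)).card : ℝ)
        ≤ ∑ j, (((Finset.Icc (-(m j : ℤ)) (m j)).image
          fun k : ℤ => (l j, h (l j) + 2 * δ * k + δ)).card : ℝ) := by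
          exact_mod_cast Finset.card_biUnion_le
      _ ≤ ∑ j, (o j / δ + 3) := Finset.sum_le_sum fun j _ => hcard j
      _ = (∑ j, o j) / δ + 3 * Fintype.card κ := by
          rw [Finset.sum_add_distrib, Finset.sum_div]; simp [mul_comm]
      _ ≤ B / δ + 3 * ((x (Fin.last N) - x 0) / (μ * δ)) := by gcongr

lemma sub_le_of_subset_biUnion_Icc {ι : Type*} (F : Finset ι) {c : ι → ℝ} {a b δ : ℝ}
    (hδ : 0 ≤ δ) (H : Icc a b ⊆ ⋃ p ∈ F, Icc (c p - δ) (c p + δ)) :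
    b - a ≤ 2 * δ * F.card := by
  have h1 := (MeasureTheory.measure_mono (μ := MeasureTheory.volume) H).trans
    (MeasureTheory.measure_biUnion_finset_le F _)
  simp only [Real.volume_Icc] at h1
  rw [← ENNReal.ofReal_sum_of_nonneg fun j _ => by linarith] at h1
  have h2 : ∑ p ∈ F, (c p + δ - (c p - δ)) = 2 * δ * F.card := by
    rw [Finset.sum_congr rfl fun p _ => (by ring : c p + δ - (c p - δ) = 2 * δ)]
    simp [mul_comm]
  rw [h2] at h1
  exact (ENNReal.ofReal_le_ofReal_iff (by positivity)).1 h1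

lemma exists_mem_of_isCover {h : ℝ → ℝ} {δ : ℝ≥0} {F : Finset (ℝ × ℝ)}
    (hF : Metric.IsCover δ (graph x h) (F : Set (ℝ × ℝ))) {t : ℝ} (ht : t ∈ interval x) :
    ∃ p ∈ F, |t - p.1| ≤ δ ∧ |h t - p.2| ≤ δ := by
  rw [Metric.isCover_iff_subset_iUnion_closedBall] at hF
  have := hF ⟨t, ht, rfl⟩
  simp only [mem_iUnion] at this
  obtain ⟨p, hp, hpt⟩ := this
  rw [Metric.mem_closedBall, Prod.dist_eq, max_le_iff, Real.dist_eq, Real.dist_eq] at hpt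
  exact ⟨p, hp, hpt⟩

lemma length_le_of_isCover {h : ℝ → ℝ} {δ : ℝ≥0} {F : Finset (ℝ × ℝ)}
    (hF : Metric.IsCover δ (graph x h) (F : Set (ℝ × ℝ))) :
    x (Fin.last N) - x 0 ≤ 2 * δ * F.card := by
  refine sub_le_of_subset_biUnion_Icc F (c := Prod.fst) δ.2 fun t ht => ?_
  obtain ⟨p, hp, h1, _⟩ := exists_mem_of_isCover hF ht
  simp only [mem_iUnion]
  exact ⟨p, hp, by linarith [(abs_le.1 h1).1], by linarith [(abs_le.1 h1).2]⟩

/-- Above an interval on which `h` increases by `Δ`, a cover of the graph needs at least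
`Δ / (2 δ)` squares, and each square lies above at most four intervals of the family. -/
lemma HasVariationAtScale.le_of_isCover {h : ℝ → ℝ} (hh : ContinuousOn h (interval x))
    {δ : ℝ≥0} (hδ : 0 < δ) {B : ℝ} (H : HasVariationAtScale x h δ B) {F : Finset (ℝ × ℝ)}
    (hF : Metric.IsCover δ (graph x h) (F : Set (ℝ × ℝ))) :
    B ≤ 8 * δ * F.card := by
  classical
  obtain ⟨κ, _, l, r, h1, h2⟩ := H
  have hδ' : (0 : ℝ) < δ := hδ
  let R : κ → ℝ × ℝ → Prop := fun j p => ∃ t ∈ Icc (l j) (r j), |t - p.1| ≤ δ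
  have hvert : ∀ j, |h (r j) - h (l j)| ≤ 2 * δ * (F.filter (R j)).card := by
    intro j
    have hle : l j ≤ r j := by linarith [h1.add_le j]
    have hsub : Icc (l j) (r j) ⊆ interval x :=
      Icc_subset_Icc (h1.left_mem j).1 (h1.right_mem j).2
    have hiv : uIcc (h (l j)) (h (r j)) ⊆ h '' uIcc (l j) (r j) :=
      intermediate_value_uIcc (by rw [uIcc_of_le hle]; exact hh.mono hsub)
    rw [← max_sub_min_eq_abs]
    refine sub_le_of_subset_biUnion_Icc _ (c := Prod.snd) hδ'.le fun y hy => ?_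
    obtain ⟨t, ht, rfl⟩ := hiv hy
    rw [uIcc_of_le hle] at ht
    obtain ⟨p, hp, hp1, hp2⟩ := exists_mem_of_isCover hF (hsub ht)
    simp only [mem_iUnion]
    exact ⟨p, Finset.mem_filter.2 ⟨hp, t, ht, hp1⟩, by linarith [(abs_le.1 hp2).1],
      by linarith [(abs_le.1 hp2).2]⟩
  have hmult : ∀ p : ℝ × ℝ, ((Finset.univ.filter fun j => R j p).card : ℝ) ≤ 4 := by
    intro p
    -- Shrink each interval that meets `[p.1 - δ, p.1 + δ]` to length `δ`, within
    -- `[p.1 - 2 * δ, p.1 + 2 * δ]`.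
    have : ∀ j, ∃ u, R j p → l j ≤ u ∧ u + δ ≤ r j ∧ p.1 - 2 * δ ≤ u ∧ u + δ ≤ p.1 + 2 * δ := by
      intro j
      by_cases hj : R j p
      · obtain ⟨t, ht, htp⟩ := hj
        have hj' := h1.add_le j
        obtain ⟨a1, a2⟩ := abs_le.1 htp
        obtain ⟨b1, b2⟩ := ht
        refine ⟨max (l j) (t - δ), fun _ => ⟨le_max_left _ _, ?_, ?_, ?_⟩⟩
        · rw [← max_add_add_right, max_le_iff]; constructor <;> linarith
        · exact le_trans (by linarith) (le_max_right _ _)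
        · rw [← max_add_add_right, max_le_iff]; constructor <;> linarith
      · exact ⟨0, fun h => absurd h hj⟩
    choose u hu using this
    have hs := sum_length_le_of_disjoint (Finset.univ.filter fun j => R j p) (l := u)
      (r := fun j => u j + δ) (a := p.1 - 2 * δ) (b := p.1 + 2 * δ) (by linarith)
      (fun j _ => by linarith)
      (fun j hj => by
        obtain ⟨_, _, h3, h4⟩ := hu j (Finset.mem_filter.1 hj).2
        exact Ioc_subset_Icc_self.trans (Icc_subset_Icc h3 h4))
      (fun i hi j hj hij => by
        obtain ⟨a1, a2, _, _⟩ := hu i (Finset.mem_filter.1 hi).2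
        obtain ⟨b1, b2, _, _⟩ := hu j (Finset.mem_filter.1 hj).2
        exact (h1.disjoint hij).mono (Ioc_subset_Ioc a1 a2) (Ioc_subset_Ioc b1 b2))
    have hs' : ((Finset.univ.filter fun j => R j p).card : ℝ) * δ ≤ 4 * δ := by
      simp only [add_sub_cancel_left, Finset.sum_const, nsmul_eq_mul] at hs
      linarith
    exact le_of_mul_le_mul_right hs' hδ'
  calc B ≤ ∑ j, |h (r j) - h (l j)| := h2
    _ ≤ ∑ j, 2 * δ * ((F.filter (R j)).card : ℝ) := Finset.sum_le_sum fun j _ => hvert j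
    _ = 2 * δ * ∑ p ∈ F, ((Finset.univ.filter fun j => R j p).card : ℝ) := by
      rw [← Finset.mul_sum]
      congr 1
      exact_mod_cast Finset.sum_card_bipartiteAbove_eq_sum_card_bipartiteBelow R
    _ ≤ 2 * δ * ∑ _p ∈ F, (4 : ℝ) := by gcongr with p; exact hmult p
    _ = 8 * δ * F.card := by simp; ring

end Oscillation

/-! ### The box dimension of a self-affine graph -/

section Dimension

lemma tendsto_log_div_neg_log {n : ℝ≥0 → ℝ} {d : ℝ}
    (lower : ∃ c : ℝ, 0 < c ∧ ∀ᶠ δ : ℝ≥0 in 𝓝[>] 0, c * (δ : ℝ) ^ (-d) ≤ n δ)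
    (upper : ∀ ε : ℝ, 0 < ε → ∃ C : ℝ, 0 < C ∧
      ∀ᶠ δ : ℝ≥0 in 𝓝[>] 0, n δ ≤ C * (δ : ℝ) ^ (-(d + ε))) :
    Tendsto (fun δ : ℝ≥0 => Real.log (n δ) / (- Real.log (δ : ℝ))) (𝓝[>] 0) (𝓝 d) := by
  have hcoe : Tendsto (fun δ : ℝ≥0 => (δ : ℝ)) (𝓝[>] 0) (𝓝[>] 0) := by
    refine tendsto_nhdsWithin_iff.2 ⟨?_, ?_⟩
    · have : Tendsto (fun δ : ℝ≥0 => (δ : ℝ)) (𝓝 0) (𝓝 0) := by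
        simpa using NNReal.continuous_coe.tendsto 0
      exact this.mono_left nhdsWithin_le_nhds
    · filter_upwards [self_mem_nhdsWithin] with δ hδ
      exact NNReal.coe_pos.2 hδ
  have hL : Tendsto (fun δ : ℝ≥0 => - Real.log (δ : ℝ)) (𝓝[>] 0) atTop :=
    tendsto_neg_atBot_atTop.comp (Real.tendsto_log_nhdsGT_zero.comp hcoe)
  have hsmall : ∀ a ε : ℝ, 0 < ε →
      ∀ᶠ δ : ℝ≥0 in 𝓝[>] 0, |Real.log a / (- Real.log (δ : ℝ))| < ε := by
    intro a ε hε
    have := (tendsto_const_nhds (x := Real.log a)).div_atTop hL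
    have := this.eventually (Metric.ball_mem_nhds 0 hε)
    filter_upwards [this] with δ hδ
    rwa [Real.dist_eq, sub_zero] at hδ
  obtain ⟨c, hc, hlow⟩ := lower
  rw [Metric.tendsto_nhds]
  intro ε hε
  obtain ⟨C, hC, hup⟩ := upper (ε / 2) (half_pos hε)
  filter_upwards [hlow, hup, hsmall c ε hε, hsmall C (ε / 2) (half_pos hε),
    hL.eventually (eventually_gt_atTop 0), self_mem_nhdsWithin] with δ h1 h2 h3 h4 h5 h6
  have hδ : (0 : ℝ) < δ := NNReal.coe_pos.2 h6
  have p1 : 0 < (δ : ℝ) ^ (-d) := Real.rpow_pos_of_pos hδ _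
  have p2 : 0 < (δ : ℝ) ^ (-(d + ε / 2)) := Real.rpow_pos_of_pos hδ _
  have hn : 0 < n δ := (mul_pos hc p1).trans_le h1
  have l1 := Real.log_le_log (mul_pos hc p1) h1
  have l2 := Real.log_le_log hn h2
  rw [Real.log_mul hc.ne' p1.ne', Real.log_rpow hδ] at l1
  rw [Real.log_mul hC.ne' p2.ne', Real.log_rpow hδ] at l2
  set L := - Real.log (δ : ℝ) with hLdef
  have hlog : Real.log (δ : ℝ) = -L := by rw [hLdef]; ring
  rw [hlog] at l1 l2
  rw [abs_lt, lt_div_iff₀ h5, div_lt_iff₀ h5] at h3 h4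
  rw [Real.dist_eq, abs_lt, lt_sub_iff_add_lt, sub_lt_iff_lt_add, lt_div_iff₀ h5, div_lt_iff₀ h5]
  constructor <;> nlinarith [h3.1, h4.2]

variable {N : ℕ} {x : Fin (N + 1) → ℝ}

lemma externalCoveringNumber_toNat_le {E : Type*} [PseudoMetricSpace E] {δ : ℝ≥0} {A : Set E}
    {F : Finset E} (hF : Metric.IsCover δ A (F : Set E)) :
    (Metric.externalCoveringNumber δ A).toNat ≤ F.card := by
  have := hF.externalCoveringNumber_le_encard
  rw [encard_coe_eq_coe_finsetCard] at this
  exact ENat.toNat_le_of_le_natCast this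

/-- For a totally bounded set the covering number is the size of some finite cover. -/
lemma exists_isCover_card_le {E : Type*} [PseudoMetricSpace E] {δ : ℝ≥0} (hδ : δ ≠ 0) {A : Set E}
    (hA : TotallyBounded A) :
    ∃ F : Finset E, Metric.IsCover δ A (F : Set E) ∧
      F.card ≤ (Metric.externalCoveringNumber δ A).toNat := by
  obtain ⟨S, _, hSf, hS⟩ := Metric.exists_finite_isCover_of_totallyBounded hδ hA
  have htop : Metric.externalCoveringNumber δ A ≠ ⊤ :=
    ne_top_of_le_ne_top hSf.encard_lt_top.ne hS.externalCoveringNumber_le_encard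
  have hlt : Metric.externalCoveringNumber δ A <
      ((Metric.externalCoveringNumber δ A).toNat + 1 : ℕ) := by
    conv_lhs => rw [← ENat.natCast_toNat htop]
    exact_mod_cast Nat.lt_succ_self _
  unfold Metric.externalCoveringNumber at hlt
  simp only [iInf_lt_iff] at hlt
  obtain ⟨T, hT, hTlt⟩ := hlt
  have hTf : T.Finite := finite_of_encard_le_coe hTlt.le
  lift T to Finset E using hTf
  rw [encard_coe_eq_coe_finsetCard] at hTlt
  refine ⟨T, hT, ?_⟩
  have := Nat.cast_lt.1 hTlt
  exact Nat.lt_succ_iff.1 this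

lemma isCompact_graph {h : ℝ → ℝ} (hh : ContinuousOn h (interval x)) : IsCompact (graph x h) :=
  isCompact_Icc.image_of_continuousOn (continuousOn_id.prodMk hh)

lemma hasBoxDim_graph (hN : 2 ≤ N) (hx : StrictMono x) {h : ℝ → ℝ}
    (hh : ContinuousOn h (interval x)) {d c δ₀ : ℝ} (hc : 0 < c) (hδ₀ : 0 < δ₀)
    (lower : ∀ δ : ℝ≥0, 0 < δ → δ ≤ δ₀ → ∀ F : Finset (ℝ × ℝ),
      Metric.IsCover δ (graph x h) (F : Set (ℝ × ℝ)) → c * (δ : ℝ) ^ (-d) ≤ F.card)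
    (upper : ∀ ε : ℝ, 0 < ε → ∃ C : ℝ, 0 < C ∧ ∃ δ₁ : ℝ, 0 < δ₁ ∧ ∀ δ : ℝ≥0, 0 < δ → δ ≤ δ₁ →
      ∃ F : Finset (ℝ × ℝ), Metric.IsCover δ (graph x h) (F : Set (ℝ × ℝ)) ∧
        (F.card : ℝ) ≤ C * (δ : ℝ) ^ (-(d + ε))) :
    HasBoxDim (graph x h) d := by
  have htb := (isCompact_graph hh).totallyBounded
  have hev : ∀ a : ℝ, 0 < a → ∀ᶠ δ : ℝ≥0 in 𝓝[>] 0, 0 < δ ∧ (δ : ℝ) ≤ a := by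
    intro a ha
    filter_upwards [self_mem_nhdsWithin,
      nhdsWithin_le_nhds (Iic_mem_nhds (Real.toNNReal_pos.2 ha))] with δ h1 h2
    exact ⟨h1, (Real.le_toNNReal_iff_coe_le ha.le).1 h2⟩
  refine ⟨⟨_, x 0, left_mem_interval hN hx, rfl⟩, htb, ?_⟩
  refine tendsto_log_div_neg_log ⟨c, hc, ?_⟩ fun ε hε => ?_
  · filter_upwards [hev δ₀ hδ₀] with δ hδ
    obtain ⟨F, hF, hcard⟩ := exists_isCover_card_le hδ.1.ne' htb
    exact (lower δ hδ.1 hδ.2 F hF).trans (by exact_mod_cast hcard)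
  · obtain ⟨C, hC, δ₁, hδ₁, H⟩ := upper ε hε
    refine ⟨C, hC, ?_⟩
    filter_upwards [hev δ₁ hδ₁] with δ hδ
    obtain ⟨F, hF, hcard⟩ := H δ hδ.1 hδ.2
    exact le_trans (by exact_mod_cast externalCoveringNumber_toNat_le hF) hcard

/-- The upper bound for the box dimension. -/
lemma exists_isCover_of_sum_lt_one (hN : 2 ≤ N) (hx : StrictMono x) {α : Fin N → ℝ}
    {h : ℝ → ℝ} (hh : ContinuousOn h (interval x)) {q : Fin N → ℝ → ℝ} {C : ℝ} (hC : 0 ≤ C)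
    (hfe : ∀ i, ∀ t ∈ interval x, h (affineMap x i t) = α i * h t + q i t)
    (hq : ∀ i, ∀ s ∈ interval x, ∀ t ∈ interval x, |q i t - q i s| ≤ C * |t - s|)
    {s : ℝ} (hs0 : 0 ≤ s) (hs : ∑ i, |α i| * ratio x i ^ s < 1) :
    ∃ C' : ℝ, 0 < C' ∧ ∃ δ₁ : ℝ, 0 < δ₁ ∧ ∀ δ : ℝ≥0, 0 < δ → δ ≤ δ₁ →
      ∃ F : Finset (ℝ × ℝ), Metric.IsCover δ (graph x h) (F : Set (ℝ × ℝ)) ∧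
        (F.card : ℝ) ≤ C' * (δ : ℝ) ^ (-(1 + s)) := by
  obtain ⟨M, hM⟩ := isCompact_Icc.exists_bound_of_continuousOn hh
  have hM' : ∀ s ∈ interval x, ∀ t ∈ interval x, |h t - h s| ≤ 2 * M := by
    intro s hs t ht
    have h1 := hM s hs
    have h2 := hM t ht
    rw [Real.norm_eq_abs] at h1 h2
    linarith [abs_sub (h t) (h s)]
  obtain ⟨μ, c, hμ, hc, H⟩ := exists_hasOscillationAtScale hN hx hC hfe hq hM' hs0 hs
  have hℓ := length_pos hN hx
  refine ⟨c + 3 * ((x (Fin.last N) - x 0) / μ), by positivity,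
    min 1 (x (Fin.last N) - x 0), lt_min one_pos hℓ, fun δ hδ hδ1 => ?_⟩
  have hδ' : (0 : ℝ) < δ := hδ
  obtain ⟨F, hF, hcard⟩ := (H δ hδ' (hδ1.trans (min_le_right _ _))).exists_isCover hμ hδ
  refine ⟨F, hF, hcard.trans ?_⟩
  have e1 : (δ : ℝ) ^ (-(1 + s)) = (δ : ℝ) ^ (-s) / δ := by
    rw [neg_add, add_comm, Real.rpow_add hδ', Real.rpow_neg_one, div_eq_mul_inv]
  have e2 : (1 : ℝ) ≤ (δ : ℝ) ^ (-s) :=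
    Real.one_le_rpow_of_pos_of_le_one_of_nonpos hδ' (hδ1.trans (min_le_left _ _)) (by linarith)
  calc c * (δ : ℝ) ^ (-s) / δ + 3 * ((x (Fin.last N) - x 0) / (μ * δ))
      = c * ((δ : ℝ) ^ (-s) / δ) + 3 * ((x (Fin.last N) - x 0) / μ) * (1 / δ) := by
        field_simp
    _ ≤ c * ((δ : ℝ) ^ (-s) / δ) + 3 * ((x (Fin.last N) - x 0) / μ) * ((δ : ℝ) ^ (-s) / δ) := by
        gcongr
    _ = _ := by rw [e1]; ring

lemma sum_mul_ratio_rpow_lt (hN : 2 ≤ N) (hx : StrictMono x) {α : Fin N → ℝ} {s ε : ℝ}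
    (hε : 0 < ε) (hs : ∑ i, |α i| * ratio x i ^ s ≤ 1) :
    ∑ i, |α i| * ratio x i ^ (s + ε) < 1 := by
  by_cases h0 : ∀ i, α i = 0
  · simp [h0]
  · push Not at h0
    obtain ⟨i, hi⟩ := h0
    have hlt : ∀ j, ratio x j ^ (s + ε) < ratio x j ^ s := fun j =>
      Real.rpow_lt_rpow_of_exponent_gt (ratio_pos hN hx j) (ratio_lt_one hN hx j) (by linarith)
    refine lt_of_lt_of_le (Finset.sum_lt_sum (fun j _ => ?_) ⟨i, Finset.mem_univ _, ?_⟩) hs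
    · exact mul_le_mul_of_nonneg_left (hlt j).le (abs_nonneg _)
    · exact mul_lt_mul_of_pos_left (hlt i) (abs_pos.2 hi)

lemma exists_exponent (hN : 2 ≤ N) (hx : StrictMono x) {α : Fin N → ℝ}
    (hα : ∀ i, α i ∈ Ioo (-1 : ℝ) 1) (hγ : 1 < ∑ i, |α i|) :
    ∃ s : ℝ, 0 ≤ s ∧ ∑ i, |α i| * ratio x i ^ s = 1 := by
  have hcont : ContinuousOn (fun s : ℝ => ∑ i, |α i| * ratio x i ^ s) (Icc 0 1) := by
    refine continuousOn_finsetSum _ fun i _ => ContinuousOn.mul continuousOn_const ?_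
    exact (Real.continuous_const_rpow (ratio_pos hN hx i).ne').continuousOn
  have h1 : ∑ i, |α i| * ratio x i ^ (1 : ℝ) ≤ 1 := by
    refine le_trans (Finset.sum_le_sum fun i _ => ?_) (sum_ratio hN hx).le
    rw [Real.rpow_one]
    exact mul_le_of_le_one_left (ratio_pos hN hx i).le (abs_le.2 ⟨(hα i).1.le, (hα i).2.le⟩)
  obtain ⟨s, hs, hs'⟩ := intermediate_value_Icc' zero_le_one hcont
    (show (1 : ℝ) ∈ Icc _ _ from ⟨h1, by simpa using hγ.le⟩)
  exact ⟨s, hs.1, hs'⟩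

lemma hasBoxDim_graph_of_sum_le_one (hN : 2 ≤ N) (hx : StrictMono x) {α : Fin N → ℝ}
    {h : ℝ → ℝ} (hh : ContinuousOn h (interval x)) {q : Fin N → ℝ → ℝ} {C : ℝ} (hC : 0 ≤ C)
    (hfe : ∀ i, ∀ t ∈ interval x, h (affineMap x i t) = α i * h t + q i t)
    (hq : ∀ i, ∀ s ∈ interval x, ∀ t ∈ interval x, |q i t - q i s| ≤ C * |t - s|)
    (hγ : ∑ i, |α i| ≤ 1) : HasBoxDim (graph x h) 1 := by
  have hℓ := length_pos hN hx
  refine hasBoxDim_graph hN hx hh (half_pos hℓ) one_pos (fun δ hδ _ F hF => ?_) fun ε hε => ?_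
  · have := length_le_of_isCover hF
    rw [Real.rpow_neg_one, ← div_eq_mul_inv, div_le_iff₀ (NNReal.coe_pos.2 hδ)]
    linarith
  · refine exists_isCover_of_sum_lt_one hN hx hh hC hfe hq hε.le ?_
    have := sum_mul_ratio_rpow_lt hN hx (α := α) (s := 0) hε (by simpa using hγ)
    simpa using this

lemma hasBoxDim_graph_of_one_lt_sum (hN : 2 ≤ N) (hx : StrictMono x) {α : Fin N → ℝ}
    {h : ℝ → ℝ} (hh : ContinuousOn h (interval x)) {q : Fin N → ℝ → ℝ} {C : ℝ} (hC : 0 ≤ C)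
    (hfe : ∀ i, ∀ t ∈ interval x, h (affineMap x i t) = α i * h t + q i t)
    (hq : ∀ i, ∀ s ∈ interval x, ∀ t ∈ interval x, |q i t - q i s| ≤ C * |t - s|)
    (hγ : 1 < ∑ i, |α i|) {s : ℝ} (hs0 : 0 ≤ s) (hs : ∑ i, |α i| * ratio x i ^ s = 1)
    (hvar : ∀ B, ∃ δ, 0 < δ ∧ HasVariationAtScale x h δ B) :
    HasBoxDim (graph x h) (1 + s) := by
  obtain ⟨δ₀, hδ₀, H⟩ := hvar (N * (C * (x (Fin.last N) - x 0)) / (∑ i, |α i| - 1) + 1)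
  obtain ⟨c, hc, H⟩ := H.exists_growth hN hx hC hfe hq hγ hs0 hs hδ₀ (lt_add_one _)
  refine hasBoxDim_graph hN hx hh (c := c / 8) (by positivity) hδ₀ (fun δ hδ hδ0 F hF => ?_)
    fun ε hε => ?_
  · have hδ' : (0 : ℝ) < δ := hδ
    have := (H δ hδ' hδ0).le_of_isCover hh hδ hF
    rw [neg_add, add_comm, Real.rpow_add hδ', Real.rpow_neg_one, ← div_eq_mul_inv,
      ← mul_div_assoc, div_le_iff₀ hδ']
    linarith
  · have := exists_isCover_of_sum_lt_one hN hx hh hC hfe hq (by linarith : 0 ≤ s + ε)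
      (sum_mul_ratio_rpow_lt hN hx hε hs.le)
    simpa only [add_assoc] using this

end Dimension

/-! ### Unbounded variation of fractal functions with polynomial data -/

/-- The total variation of `f` along finite families of nonoverlapping intervals is at most `K`. -/
def HasVariationLE {N : ℕ} (x : Fin (N + 1) → ℝ) (f : ℝ → ℝ) (K : ℝ) : Prop :=
  ∀ (κ : Type) [Fintype κ] (δ : ℝ) (l r : κ → ℝ), 0 < δ → IsNonOverlapping x δ l r →
    ∑ j, |f (r j) - f (l j)| ≤ K

/-- The polynomial that defines `affineMap x i`. -/
noncomputable def affinePoly {N : ℕ} (x : Fin (N + 1) → ℝ) (i : Fin N) : Polynomial ℝ :=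
  Polynomial.C (ratio x i) * Polynomial.X + Polynomial.C (x i.castSucc - ratio x i * x 0)

/-- The linear operator `p ↦ ∑ σ_i (p ∘ L_i)` on polynomials. -/
noncomputable def sumCompOp {N : ℕ} (x : Fin (N + 1) → ℝ) (σ : Fin N → ℝ) :
    Polynomial ℝ →ₗ[ℝ] Polynomial ℝ :=
  ∑ i, σ i • (Polynomial.aeval (affinePoly x i)).toLinearMap

section Rigidity

variable {N : ℕ} {x : Fin (N + 1) → ℝ}

lemma eval_affinePoly (i : Fin N) (t : ℝ) : (affinePoly x i).eval t = affineMap x i t := by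
  simp only [affinePoly, affineMap, ratio, Polynomial.eval_add, Polynomial.eval_mul,
    Polynomial.eval_C, Polynomial.eval_X]
  ring

lemma sumCompOp_apply (σ : Fin N → ℝ) (p : Polynomial ℝ) :
    sumCompOp x σ p = ∑ i, σ i • p.comp (affinePoly x i) := by
  simp [sumCompOp, LinearMap.sum_apply, Polynomial.comp_eq_aeval]

lemma eval_sumCompOp (σ : Fin N → ℝ) (p : Polynomial ℝ) (t : ℝ) :
    (sumCompOp x σ p).eval t = ∑ i, σ i * p.eval (affineMap x i t) := by
  simp [sumCompOp_apply, Polynomial.eval_finsetSum, Polynomial.eval_smul, Polynomial.eval_comp,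
    eval_affinePoly]

lemma natDegree_sumCompOp_le (σ : Fin N → ℝ) (p : Polynomial ℝ) :
    (sumCompOp x σ p).natDegree ≤ p.natDegree := by
  rw [sumCompOp_apply]
  refine Polynomial.natDegree_sum_le_of_forall_le _ _ fun i _ => ?_
  refine (Polynomial.natDegree_smul_le _ _).trans (Polynomial.natDegree_comp_le.trans ?_)
  exact mul_le_of_le_one_right (Nat.zero_le _) Polynomial.natDegree_linear_le

lemma HasVariationLE.sub {f g : ℝ → ℝ} {K K' : ℝ} (hf : HasVariationLE x f K)
    (hg : HasVariationLE x g K') : HasVariationLE x (fun t => f t - g t) (K + K') := by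
  intro κ _ δ l r hδ H
  refine le_trans ?_ (add_le_add (hf κ δ l r hδ H) (hg κ δ l r hδ H))
  rw [← Finset.sum_add_distrib]
  refine Finset.sum_le_sum fun j _ => ?_
  calc |f (r j) - g (r j) - (f (l j) - g (l j))|
      = |(f (r j) - f (l j)) - (g (r j) - g (l j))| := by ring_nf
    _ ≤ _ := abs_sub _ _

lemma hasVariationLE_of_lipschitz (hN : 2 ≤ N) (hx : StrictMono x) {f : ℝ → ℝ} {C : ℝ}
    (hC : 0 ≤ C) (hf : ∀ s ∈ interval x, ∀ t ∈ interval x, |f t - f s| ≤ C * |t - s|) :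
    HasVariationLE x f (C * (x (Fin.last N) - x 0)) := by
  intro κ _ δ l r hδ H
  refine le_trans ?_ (mul_le_mul_of_nonneg_left (H.sum_length_le hN hx hδ.le) hC)
  rw [Finset.mul_sum]
  refine Finset.sum_le_sum fun j _ => ?_
  have := hf _ (H.left_mem j) _ (H.right_mem j)
  rwa [abs_of_nonneg (by linarith [H.add_le j] : 0 ≤ r j - l j)] at this

lemma exists_lipschitz_eval (p : Polynomial ℝ) :
    ∃ C : ℝ, 0 ≤ C ∧
      ∀ s ∈ interval x, ∀ t ∈ interval x, |p.eval t - p.eval s| ≤ C * |t - s| := by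
  have hp : ContDiff ℝ 1 fun t => p.eval t := by simpa using p.contDiff_aeval (𝕜 := ℝ) 1
  obtain ⟨C, hC⟩ := hp.contDiffOn.exists_lipschitzOnWith one_ne_zero
    (convex_Icc (x 0) (x (Fin.last N))) isCompact_Icc
  refine ⟨C, C.2, fun s hs t ht => ?_⟩
  simpa [Real.dist_eq] using hC.dist_le_mul t ht s hs

/-- A function of bounded variation with `γ R = ∑ σ_i (R ∘ L_i) + c`, where `|σ_i| ≤ 1 < γ`, is
constant: its variation is at most `1 / γ` times itself. -/
lemma eq_of_hasVariationLE (hN : 2 ≤ N) (hx : StrictMono x) {σ : Fin N → ℝ}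
    (hσ : ∀ i, |σ i| ≤ 1) {γ c : ℝ} (hγ : 1 < γ) {R : ℝ → ℝ}
    (hR : ∀ t ∈ interval x, γ * R t = ∑ i, σ i * R (affineMap x i t) + c) {K : ℝ}
    (hK : HasVariationLE x R K) {t : ℝ} (ht : t ∈ interval x) : R t = R (x 0) := by
  have hγ0 : 0 < γ := by linarith
  obtain ⟨μ, hμ0, _, hμ⟩ := exists_le_ratio hN hx
  have step : ∀ K, HasVariationLE x R K → HasVariationLE x R (K / γ) := by
    intro K hK κ _ δ l r hδ H
    have h1 := hK (Σ _ : Fin N, κ) (μ * δ) _ _ (by positivity)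
      (IsNonOverlapping.sigma hN hx (η := fun _ => δ) (fun _ => H) fun i => by gcongr; exact hμ i)
    rw [Fintype.sum_sigma, Finset.sum_comm] at h1
    rw [le_div_iff₀ hγ0, Finset.sum_mul]
    refine le_trans (Finset.sum_le_sum fun j _ => ?_) h1
    have e : (R (r j) - R (l j)) * γ =
        ∑ i, σ i * (R (affineMap x i (r j)) - R (affineMap x i (l j))) := by
      have e1 := hR _ (H.left_mem j)
      have e2 := hR _ (H.right_mem j)
      simp only [mul_sub, Finset.sum_sub_distrib]
      linarith
    rw [← abs_of_pos hγ0, ← abs_mul, e]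
    refine (Finset.abs_sum_le_sum_abs _ _).trans (Finset.sum_le_sum fun i _ => ?_)
    rw [abs_mul]
    exact mul_le_of_le_one_left (abs_nonneg _) (hσ i)
  have hpow : ∀ n : ℕ, HasVariationLE x R (K / γ ^ n) := by
    intro n
    induction n with
    | zero => simpa using hK
    | succ n ih => rw [pow_succ, ← div_div]; exact step _ ih
  rcases eq_or_lt_of_le ht.1 with h | h
  · rw [← h]
  have hsingle : ∀ n : ℕ, |R t - R (x 0)| ≤ K / γ ^ n := by
    intro n
    have := hpow n Unit (t - x 0) (fun _ => x 0) (fun _ => t) (sub_pos.2 h)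
      ⟨fun _ => left_mem_interval hN hx, fun _ => ht, fun _ => by simp,
        fun i j hij => absurd (Subsingleton.elim i j) hij⟩
    simpa using this
  have hlim : Tendsto (fun n : ℕ => K / γ ^ n) atTop (𝓝 0) :=
    tendsto_const_nhds.div_atTop (tendsto_pow_atTop_atTop_of_one_lt hγ)
  have := ge_of_tendsto' hlim hsingle
  exact sub_eq_zero.1 (abs_eq_zero.1 (le_antisymm this (abs_nonneg _)))

lemma interval_infinite (hN : 2 ≤ N) (hx : StrictMono x) : (interval x).Infinite :=
  Icc_infinite (sub_pos.1 (length_pos hN hx))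

lemma polynomial_eq_of_eqOn_interval (hN : 2 ≤ N) (hx : StrictMono x) {p p' : Polynomial ℝ}
    (H : ∀ t ∈ interval x, p.eval t = p'.eval t) : p = p' :=
  Polynomial.eq_of_infinite_eval_eq _ _ ((interval_infinite hN hx).mono H)

/-- Modulo constants, `γ - sumCompOp x σ` is onto on polynomials: on polynomials of bounded degree
it is injective by `eq_of_hasVariationLE`. -/
lemma exists_polynomial_solution (hN : 2 ≤ N) (hx : StrictMono x) {σ : Fin N → ℝ}
    (hσ : ∀ i, |σ i| ≤ 1) {γ : ℝ} (hγ : 1 < γ) (p : Polynomial ℝ) :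
    ∃ (P : Polynomial ℝ) (c : ℝ), γ • P = sumCompOp x σ P + p + Polynomial.C c := by
  -- `Ψ` is `γ - sumCompOp x σ` corrected by a constant so that nonzero constants are not killed.
  let Ψ : Polynomial ℝ →ₗ[ℝ] Polynomial ℝ := γ • LinearMap.id - (sumCompOp x σ -
    (Polynomial.aeval (Polynomial.C (x 0))).toLinearMap ∘ₗ sumCompOp x σ)
  have hΨ : ∀ P, Ψ P = γ • P - (sumCompOp x σ P -
      Polynomial.C ((sumCompOp x σ P).eval (x 0))) := by
    intro P
    simp [Ψ, ← Polynomial.comp_eq_aeval, Polynomial.comp_C]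
  set n := p.natDegree with hn
  have hmem : ∀ P, P ∈ Polynomial.degreeLT ℝ (n + 1) ↔ P.natDegree ≤ n := by
    intro P
    rw [Polynomial.degreeLT_succ_eq_degreeLE, Polynomial.mem_degreeLE,
      Polynomial.natDegree_le_iff_degree_le]
  have hmaps : ∀ P ∈ Polynomial.degreeLT ℝ (n + 1), Ψ P ∈ Polynomial.degreeLT ℝ (n + 1) := by
    intro P hP
    rw [hΨ]
    have hT : sumCompOp x σ P ∈ Polynomial.degreeLT ℝ (n + 1) :=
      (hmem _).2 ((natDegree_sumCompOp_le σ P).trans ((hmem _).1 hP))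
    exact Submodule.sub_mem _ (Submodule.smul_mem _ _ hP)
      (Submodule.sub_mem _ hT ((hmem _).2 (by simp)))
  have hinj : ∀ P, Ψ P = 0 → P = 0 := by
    intro P hP
    rw [hΨ, sub_eq_zero] at hP
    have hev : ∀ t, γ * P.eval t = ∑ i, σ i * P.eval (affineMap x i t) +
        -(sumCompOp x σ P).eval (x 0) := by
      intro t
      have := congrArg (Polynomial.eval t) hP
      simp only [Polynomial.eval_smul, smul_eq_mul, Polynomial.eval_sub, Polynomial.eval_C] at this
      rw [this, eval_sumCompOp, sub_eq_add_neg]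
    obtain ⟨C, hC, hlip⟩ := exists_lipschitz_eval (x := x) P
    have h0 : P.eval (x 0) = 0 := by
      have := hev (x 0)
      rw [eval_sumCompOp, add_neg_cancel] at this
      exact (mul_eq_zero.1 this).resolve_left (by linarith)
    refine polynomial_eq_of_eqOn_interval hN hx fun t ht => ?_
    rw [eq_of_hasVariationLE hN hx hσ hγ (R := fun t => P.eval t) (fun t _ => hev t)
      (hasVariationLE_of_lipschitz hN hx hC hlip) ht, h0, Polynomial.eval_zero]
  have hfin : FiniteDimensional ℝ (Polynomial.degreeLT ℝ (n + 1)) :=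
    Module.Finite.equiv (Polynomial.degreeLTEquiv ℝ (n + 1)).symm
  have hsurj : Function.Surjective (Ψ.restrict hmaps) := by
    rw [← LinearMap.injective_iff_surjective, injective_iff_map_eq_zero]
    intro P hP
    exact Subtype.ext (hinj P.1 (congrArg Subtype.val hP))
  obtain ⟨P, hP⟩ := hsurj ⟨p, (hmem p).2 le_rfl⟩
  have hP' : Ψ P.1 = p := congrArg Subtype.val hP
  rw [hΨ] at hP'
  refine ⟨P.1, -(sumCompOp x σ P.1).eval (x 0), ?_⟩
  rw [Polynomial.C_neg]
  linear_combination hP'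

/-- The preimages under `L_i` and `L_j` of the least root of `U`, and likewise of its greatest root,
coincide, since the roots of `V` are carried onto the roots of `U` by both maps. -/
lemma index_eq_of_comp_eq (hN : 2 ≤ N) (hx : StrictMono x) {U V : Polynomial ℝ} (hU : U ≠ 0)
    (h0 : U.eval (x 0) = 0) (h1 : U.eval (x (Fin.last N)) = 0) {a b : ℝ} (ha : a ≠ 0)
    {i j : Fin N} (hi : ∀ t, U.eval (affineMap x i t) = a * V.eval t)
    (hj : ∀ t, U.eval (affineMap x j t) = b * V.eval t) (hb : b ≠ 0) : i = j := by
  classical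
  have hmem : ∀ t, t ∈ U.roots.toFinset ↔ U.eval t = 0 := by
    intro t
    rw [Multiset.mem_toFinset, Polynomial.mem_roots hU, Polynomial.IsRoot.def]
  have hne : U.roots.toFinset.Nonempty := ⟨_, (hmem _).2 h0⟩
  have surj : ∀ i z, ∃ s, affineMap x i s = z := fun i z => ⟨_, affineMap_affineInv hN hx i z⟩
  have hij : ∀ s, U.eval (affineMap x i s) = 0 ↔ U.eval (affineMap x j s) = 0 := by
    intro s
    rw [hi, hj, mul_eq_zero, mul_eq_zero, or_iff_right ha, or_iff_right hb]
  have mi := affineMap_strictMono hN hx i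
  have mj := affineMap_strictMono hN hx j
  have low : ∃ s, affineMap x i s = U.roots.toFinset.min' hne ∧
      affineMap x j s = U.roots.toFinset.min' hne := by
    set z := U.roots.toFinset.min' hne with hz
    have hz0 : U.eval z = 0 := (hmem z).1 (Finset.min'_mem _ _)
    have hzle : ∀ t, U.eval t = 0 → z ≤ t := fun t ht => Finset.min'_le _ _ ((hmem t).2 ht)
    obtain ⟨s, hs⟩ := surj i z
    obtain ⟨s', hs'⟩ := surj j z
    have e1 := hzle _ ((hij s).1 (by rw [hs, hz0]))
    have e2 := hzle _ ((hij s').2 (by rw [hs', hz0]))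
    have : s = s' := le_antisymm (by rw [← mi.le_iff_le, hs]; exact e2)
      (by rw [← mj.le_iff_le, hs']; exact e1)
    exact ⟨s, hs, by rw [this, hs']⟩
  have high : ∃ s, affineMap x i s = U.roots.toFinset.max' hne ∧
      affineMap x j s = U.roots.toFinset.max' hne := by
    set z := U.roots.toFinset.max' hne with hz
    have hz0 : U.eval z = 0 := (hmem z).1 (Finset.max'_mem _ _)
    have hzle : ∀ t, U.eval t = 0 → t ≤ z := fun t ht => Finset.le_max' _ _ ((hmem t).2 ht)
    obtain ⟨s, hs⟩ := surj i z
    obtain ⟨s', hs'⟩ := surj j z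
    have e1 := hzle _ ((hij s).1 (by rw [hs, hz0]))
    have e2 := hzle _ ((hij s').2 (by rw [hs', hz0]))
    have : s = s' := le_antisymm (by rw [← mj.le_iff_le, hs']; exact e1)
      (by rw [← mi.le_iff_le, hs]; exact e2)
    exact ⟨s, hs, by rw [this, hs']⟩
  obtain ⟨s, hs1, hs2⟩ := low
  obtain ⟨t, ht1, ht2⟩ := high
  have hlt : U.roots.toFinset.min' hne < U.roots.toFinset.max' hne :=
    (Finset.min'_le _ _ ((hmem _).2 h0)).trans_lt ((sub_pos.1 (length_pos hN hx)).trans_le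
      (Finset.le_max' _ _ ((hmem _).2 h1)))
  have hst : s < t := by rw [← mi.lt_iff_lt, hs1, ht1]; exact hlt
  have hr : ratio x i = ratio x j := by
    have e1 := affineMap_sub (x := x) i s t
    have e2 := affineMap_sub (x := x) j s t
    rw [hs1, ht1] at e1
    rw [hs2, ht2] at e2
    exact mul_right_cancel₀ (sub_pos.2 hst).ne' (e1.symm.trans e2)
  have hleft : x i.castSucc = x j.castSucc := by
    have e1 := affineMap_sub (x := x) i (x 0) s
    have e2 := affineMap_sub (x := x) j (x 0) s
    rw [affineMap_left, hs1, hr] at e1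
    rw [affineMap_left, hs2] at e2
    linarith
  exact Fin.castSucc_injective N (hx.injective hleft)

lemma exists_ne_ne_zero_of_one_lt_sum {α : Fin N → ℝ} (hα : ∀ i, α i ∈ Ioo (-1 : ℝ) 1)
    (hγ : 1 < ∑ i, |α i|) : ∃ i j, i ≠ j ∧ α i ≠ 0 ∧ α j ≠ 0 := by
  by_contra! H
  obtain ⟨i, -, hi⟩ : ∃ i ∈ Finset.univ, |α i| ≠ 0 :=
    Finset.exists_ne_zero_of_sum_ne_zero (by linarith)
  rw [Finset.sum_eq_single i (fun j _ hj => by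
    rw [H i j hj.symm (abs_ne_zero.1 hi), abs_zero]) (by simp)] at hγ
  exact absurd (abs_lt.2 (hα i)) hγ.le.not_gt

/-- With polynomial germ and base and `∑ |α_i| > 1`, a fractal function has unbounded variation.
Otherwise `h - b` would be a polynomial: the functional equation, weighted with the signs of the
`α_i`, determines `h - b` up to constants among functions of bounded variation, and it has a
polynomial solution. The functional equation excludes polynomials by `index_eq_of_comp_eq`. -/
lemma exists_hasVariationAtScale (hN : 2 ≤ N) (hx : StrictMono x) {α : Fin N → ℝ}
    (hα : ∀ i, α i ∈ Ioo (-1 : ℝ) 1) (hγ : 1 < ∑ i, |α i|) {g b : Polynomial ℝ} {h : ℝ → ℝ}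
    (hfe : ∀ i, ∀ t ∈ interval x, h (affineMap x i t) =
      α i * h t + (g.eval (affineMap x i t) - α i * b.eval t))
    (h0 : h (x 0) = g.eval (x 0)) (h1 : h (x (Fin.last N)) = g.eval (x (Fin.last N)))
    (hne : ¬ EqOn (fun t => b.eval t) (fun t => g.eval t) (interval x)) (B : ℝ) :
    ∃ δ, 0 < δ ∧ HasVariationAtScale x h δ B := by
  by_contra! H
  have hBV : HasVariationLE x h B := by
    intro κ _ δ l r hδ hlr
    by_contra! hlt
    exact H δ hδ ⟨κ, inferInstance, l, r, hlr, hlt.le⟩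
  set γ := ∑ i, |α i| with hγdef
  set σ : Fin N → ℝ := fun i => (SignType.sign (α i) : ℝ) with hσdef
  have hσ : ∀ i, |σ i| ≤ 1 := by
    intro i
    simp only [hσdef]
    rcases lt_trichotomy (α i) 0 with h | h | h <;> simp [h]
  have hσα : ∀ i, σ i * α i = |α i| := fun i => by simp [hσdef]
  obtain ⟨P, c, hP⟩ := exists_polynomial_solution hN hx hσ hγ (-(sumCompOp x σ (g - b)))
  have hPev : ∀ t, γ * P.eval t = ∑ i, σ i * P.eval (affineMap x i t) -
      ∑ i, σ i * (g - b).eval (affineMap x i t) + c := by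
    intro t
    have := congrArg (Polynomial.eval t) hP
    simp only [Polynomial.eval_smul, smul_eq_mul, Polynomial.eval_add, Polynomial.eval_neg,
      Polynomial.eval_C, eval_sumCompOp] at this
    rw [this]
    ring
  have hVev : ∀ t ∈ interval x, γ * (h t - b.eval t) =
      ∑ i, σ i * (h (affineMap x i t) - b.eval (affineMap x i t)) -
      ∑ i, σ i * (g - b).eval (affineMap x i t) := by
    intro t ht
    rw [hγdef, Finset.sum_mul, ← Finset.sum_sub_distrib]
    refine Finset.sum_congr rfl fun i _ => ?_
    rw [hfe i t ht, ← hσα, Polynomial.eval_sub]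
    ring
  obtain ⟨Cb, hCb, hb⟩ := exists_lipschitz_eval (x := x) b
  obtain ⟨CP, hCP, hPl⟩ := exists_lipschitz_eval (x := x) P
  have hR := fun t (ht : t ∈ interval x) => eq_of_hasVariationLE hN hx hσ hγ (c := -c)
    (R := fun t => h t - b.eval t - P.eval t)
    (fun t ht => by
      have e1 := hPev t
      have e2 := hVev t ht
      simp only [mul_sub, Finset.sum_sub_distrib] at e1 e2 ⊢
      linarith)
    ((hBV.sub (hasVariationLE_of_lipschitz hN hx hCb hb)).sub
      (hasVariationLE_of_lipschitz hN hx hCP hPl)) ht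
  set V : Polynomial ℝ := P + Polynomial.C (h (x 0) - b.eval (x 0) - P.eval (x 0)) with hV
  have hVh : ∀ t ∈ interval x, V.eval t = h t - b.eval t := by
    intro t ht
    have := hR t ht
    simp only [hV, Polynomial.eval_add, Polynomial.eval_C]
    linarith
  set U : Polynomial ℝ := V + b - g with hUdef
  have hUh : ∀ t ∈ interval x, U.eval t = h t - g.eval t := by
    intro t ht
    rw [hUdef, Polynomial.eval_sub, Polynomial.eval_add, hVh t ht]
    ring
  have hUV : ∀ i t, U.eval (affineMap x i t) = α i * V.eval t := by
    intro i t
    have : U.comp (affinePoly x i) = Polynomial.C (α i) * V := by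
      refine polynomial_eq_of_eqOn_interval hN hx fun t ht => ?_
      rw [Polynomial.eval_comp, eval_affinePoly, hUh _ (affineMap_mem hN hx i ht), hfe i t ht,
        Polynomial.eval_mul, Polynomial.eval_C, hVh t ht]
      ring
    have := congrArg (Polynomial.eval t) this
    rwa [Polynomial.eval_comp, eval_affinePoly, Polynomial.eval_mul, Polynomial.eval_C] at this
  obtain ⟨i, j, hij, hi, hj⟩ := exists_ne_ne_zero_of_one_lt_sum hα hγ
  have hU0 : U ≠ 0 := by
    intro hU
    refine hne fun t ht => ?_
    have e1 : V.eval t = 0 := by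
      have := hUV i t
      rw [hU, Polynomial.eval_zero] at this
      exact (mul_eq_zero.1 this.symm).resolve_left hi
    have e2 : U.eval t = 0 := by rw [hU, Polynomial.eval_zero]
    rw [hUdef, Polynomial.eval_sub, Polynomial.eval_add, e1] at e2
    simp only
    linarith
  refine hij (index_eq_of_comp_eq hN hx hU0 ?_ ?_ hi (hUV i) (hUV j) hj)
  · rw [hUh _ (left_mem_interval hN hx), h0, sub_self]
  · rw [hUh _ (right_mem_interval hN hx), h1, sub_self]

end Rigidity

/-! ### Existence of fractal functions -/

open Classical in
/-- The linear part of the Read–Bajraktarević operator: on the subinterval number `i` the value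
is `α_i * v (L_i⁻¹ t)`. At a common end point of two subintervals one of them is chosen. -/
noncomputable def gluing {N : ℕ} (x : Fin (N + 1) → ℝ) (α : Fin N → ℝ) (v : ℝ → ℝ) (t : ℝ) : ℝ :=
  if H : ∃ i : Fin N, t ∈ Icc (x i.castSucc) (x i.succ) then
    α H.choose * v (affineInv x H.choose t) else 0

section Existence

variable {N : ℕ} {x : Fin (N + 1) → ℝ} {α : Fin N → ℝ}

lemma gluing_affineMap (hN : 2 ≤ N) (hx : StrictMono x) {v : ℝ → ℝ} (h0 : v (x 0) = 0)
    (h1 : v (x (Fin.last N)) = 0) (i : Fin N) {t : ℝ} (ht : t ∈ interval x) :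
    gluing x α v (affineMap x i t) = α i * v t := by
  have H : ∃ j : Fin N, affineMap x i t ∈ Icc (x j.castSucc) (x j.succ) :=
    ⟨i, affineMap_mem_Icc hN hx i ht⟩
  rw [gluing, dif_pos H]
  have hj := H.choose_spec
  set j := H.choose
  have hs := affineInv_mem hN hx j hj
  have hsj := affineMap_affineInv hN hx j (affineMap x i t)
  set s := affineInv x j (affineMap x i t)
  have mi := (affineMap_strictMono hN hx i).injective
  have mj := (affineMap_strictMono hN hx j).injective
  -- If the chosen index differs from `i`, the point is a node, where `v` contributes zero.
  rcases lt_trichotomy i j with hij | hij | hij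
  · have e1 := affineMap_le_affineMap hN hx hij (right_mem_interval hN hx)
      (left_mem_interval hN hx)
    have e2 := (affineMap_strictMono hN hx i).monotone ht.2
    have e3 := (affineMap_strictMono hN hx j).monotone hs.1
    have ht1 : t = x (Fin.last N) := mi (by linarith)
    have hs1 : s = x 0 := mj (by linarith)
    rw [ht1, hs1, h0, h1, mul_zero, mul_zero]
  · rw [← hij] at hsj
    rw [mi hsj, hij]
  · have e1 := affineMap_le_affineMap hN hx hij (right_mem_interval hN hx)
      (left_mem_interval hN hx)
    have e2 := (affineMap_strictMono hN hx i).monotone ht.1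
    have e3 := (affineMap_strictMono hN hx j).monotone hs.2
    have ht1 : t = x 0 := mi (by linarith)
    have hs1 : s = x (Fin.last N) := mj (by linarith)
    rw [ht1, hs1, h0, h1, mul_zero, mul_zero]

lemma gluing_left (hN : 2 ≤ N) (hx : StrictMono x) {v : ℝ → ℝ} (h0 : v (x 0) = 0)
    (h1 : v (x (Fin.last N)) = 0) : gluing x α v (x 0) = 0 := by
  have := gluing_affineMap (α := α) hN hx h0 h1 ⟨0, by omega⟩ (left_mem_interval hN hx)
  rw [affineMap_left, h0, mul_zero] at this
  exact this

lemma gluing_right (hN : 2 ≤ N) (hx : StrictMono x) {v : ℝ → ℝ} (h0 : v (x 0) = 0)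
    (h1 : v (x (Fin.last N)) = 0) : gluing x α v (x (Fin.last N)) = 0 := by
  obtain ⟨M, rfl⟩ : ∃ M, N = M + 1 := ⟨N - 1, by omega⟩
  have := gluing_affineMap (α := α) hN hx h0 h1 (Fin.last M) (right_mem_interval hN hx)
  rw [affineMap_right hN hx, h1, mul_zero, Fin.succ_last] at this
  exact this

lemma continuousOn_gluing (hN : 2 ≤ N) (hx : StrictMono x) {v : ℝ → ℝ}
    (hv : ContinuousOn v (interval x)) (h0 : v (x 0) = 0) (h1 : v (x (Fin.last N)) = 0) :
    ContinuousOn (gluing x α v) (interval x) := by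
  have hsub : interval x ⊆ ⋃ i : Fin N, Icc (x i.castSucc) (x i.succ) := fun t ht =>
    mem_iUnion.2 (exists_mem_Icc_node hN hx ht)
  refine ContinuousOn.mono ?_ hsub
  refine (locallyFinite_of_finite _).continuousOn_iUnion (fun i => isClosed_Icc) fun i => ?_
  have hc : ContinuousOn (fun t => α i * v (affineInv x i t)) (Icc (x i.castSucc) (x i.succ)) := by
    refine continuousOn_const.mul (hv.comp ?_ fun t ht => affineInv_mem hN hx i ht)
    unfold affineInv
    fun_prop
  refine hc.congr fun t ht => ?_
  have := gluing_affineMap (α := α) hN hx h0 h1 i (affineInv_mem hN hx i ht)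
  rwa [affineMap_affineInv hN hx] at this

/-- The functional equation of the fractal function of `g` and `b` has a continuous solution, given
by the Neumann series of the Read–Bajraktarević operator; its distance from `g` is controlled
by the distance of `g` and `b`. -/
lemma exists_fractal_function (hN : 2 ≤ N) (hx : StrictMono x) {a : ℝ} (ha : a < 1)
    (hα : ∀ i, |α i| ≤ a) {g b : ℝ → ℝ} (hg : ContinuousOn g (interval x))
    (hb : ContinuousOn b (interval x)) (h0 : b (x 0) = g (x 0))
    (h1 : b (x (Fin.last N)) = g (x (Fin.last N))) :
    ∃ h : ℝ → ℝ, ContinuousOn h (interval x) ∧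
      (∀ i, ∀ t ∈ interval x, h (affineMap x i t) =
        α i * h t + (g (affineMap x i t) - α i * b t)) ∧
      h (x 0) = g (x 0) ∧ h (x (Fin.last N)) = g (x (Fin.last N)) ∧
      ∀ M, (∀ t ∈ interval x, |g t - b t| ≤ M) →
        ∀ t ∈ interval x, |h t - g t| ≤ M / (1 - a) := by
  have ha0 : 0 ≤ a := (abs_nonneg _).trans (hα ⟨0, by omega⟩)
  set φ : ℝ → ℝ := fun t => g t - b t with hφ
  set ψ : ℕ → ℝ → ℝ := fun k => (gluing x α)^[k] φ with hψ
  have hsucc : ∀ k, ψ (k + 1) = gluing x α (ψ k) := fun k =>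
    Function.iterate_succ_apply' _ _ _
  have hends : ∀ k, ψ k (x 0) = 0 ∧ ψ k (x (Fin.last N)) = 0 := by
    intro k
    induction k with
    | zero => exact ⟨by simp [hψ, hφ, h0], by simp [hψ, hφ, h1]⟩
    | succ k ih =>
      rw [hsucc]
      exact ⟨gluing_left hN hx ih.1 ih.2, gluing_right hN hx ih.1 ih.2⟩
  have hcont : ∀ k, ContinuousOn (ψ k) (interval x) := by
    intro k
    induction k with
    | zero => exact hg.sub hb
    | succ k ih => rw [hsucc]; exact continuousOn_gluing hN hx ih (hends k).1 (hends k).2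
  have happ : ∀ k i, ∀ t ∈ interval x, ψ (k + 1) (affineMap x i t) = α i * ψ k t := by
    intro k i t ht
    rw [hsucc, gluing_affineMap hN hx (hends k).1 (hends k).2 i ht]
  have hbound : ∀ M, (∀ t ∈ interval x, |φ t| ≤ M) →
      ∀ k, ∀ t ∈ interval x, |ψ k t| ≤ M * a ^ k := by
    intro M hM k
    induction k with
    | zero => simpa [hψ] using hM
    | succ k ih =>
      intro t ht
      obtain ⟨i, s, hs, rfl⟩ := exists_affineMap_eq hN hx ht
      rw [happ k i s hs, abs_mul]
      calc |α i| * |ψ k s| ≤ a * (M * a ^ k) :=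
            mul_le_mul (hα i) (ih s hs) (abs_nonneg _) ha0
        _ = M * a ^ (k + 1) := by ring
  obtain ⟨M₀, hM₀⟩ := isCompact_Icc.exists_bound_of_continuousOn (hg.sub hb)
  have hM₀' : ∀ t ∈ interval x, |φ t| ≤ M₀ := hM₀
  have hgeo : ∀ M, Summable fun k : ℕ => M * a ^ k := fun M =>
    (summable_geometric_of_lt_one ha0 ha).mul_left M
  have hgeo' : ∀ M, Summable fun k : ℕ => M * a ^ (k + 1) := fun M =>
    (summable_nat_add_iff 1).2 (hgeo M)
  have hsum : ∀ t ∈ interval x, Summable fun k => ψ k t := fun t ht =>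
    Summable.of_norm_bounded (hgeo M₀) fun k => hbound M₀ hM₀' k t ht
  refine ⟨fun t => g t + ∑' k, ψ (k + 1) t, ?_, ?_, ?_, ?_, ?_⟩
  · exact hg.add (continuousOn_tsum (fun k => hcont (k + 1)) (hgeo' M₀)
      fun k t ht => hbound M₀ hM₀' (k + 1) t ht)
  · intro i t ht
    simp only [happ _ i t ht]
    rw [tsum_mul_left, (hsum t ht).tsum_eq_zero_add]
    have : ψ 0 t = g t - b t := rfl
    rw [this]
    ring
  · simp [(hends _).1]
  · simp [(hends _).2]
  · intro M hM t ht
    have hM0 : 0 ≤ M := (abs_nonneg _).trans (hM t ht)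
    rw [add_sub_cancel_left]
    have hle : ∀ k, ‖ψ (k + 1) t‖ ≤ M * a ^ k := fun k =>
      (hbound M hM (k + 1) t ht).trans (by
        rw [pow_succ]
        have : 0 ≤ a ^ k := pow_nonneg ha0 k
        exact mul_le_mul_of_nonneg_left (mul_le_of_le_one_right this ha.le) hM0)
    refine (tsum_of_norm_bounded (hgeo M).hasSum hle).trans ?_
    rw [tsum_mul_left, tsum_geometric_of_lt_one ha0 ha, div_eq_mul_inv]

lemma isAttractor_graph (hN : 2 ≤ N) (hx : StrictMono x) {g b h : ℝ → ℝ}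
    (hh : ContinuousOn h (interval x))
    (hfe : ∀ i, ∀ t ∈ interval x, h (affineMap x i t) =
      α i * h t + (g (affineMap x i t) - α i * b t)) :
    IsAttractor (interval x ×ˢ univ) (ifsMap x α g b) (graph x h) := by
  have hW : ∀ i, ∀ t ∈ interval x,
      ifsMap x α g b i (t, h t) = (affineMap x i t, h (affineMap x i t)) := by
    intro i t ht
    rw [hfe i t ht, ifsMap, add_sub_assoc]
  refine ⟨?_, ⟨_, x 0, left_mem_interval hN hx, rfl⟩, isCompact_graph hh, ?_⟩
  · rintro _ ⟨t, ht, rfl⟩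
    exact ⟨ht, mem_univ _⟩
  · ext p
    simp only [mem_iUnion]
    constructor
    · rintro ⟨t, ht, rfl⟩
      obtain ⟨i, s, hs, rfl⟩ := exists_affineMap_eq hN hx ht
      exact ⟨i, _, ⟨s, hs, rfl⟩, hW i s hs⟩
    · rintro ⟨i, _, ⟨s, hs, rfl⟩, rfl⟩
      exact ⟨_, affineMap_mem hN hx i hs, (hW i s hs).symm⟩

/-- For polynomial germs and bases, the box dimension of the graph of the fractal function depends
only on the partition and the scaling vector. -/
lemma exists_alphaFractal_hasBoxDim (hN : 2 ≤ N) (hx : StrictMono x)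
    (hα : ∀ i, α i ∈ Ioo (-1 : ℝ) 1) :
    ∃ d A : ℝ, 0 < A ∧ ∀ g b : Polynomial ℝ,
      IsAdmissible x (fun t => g.eval t) (fun t => b.eval t) →
      ∃ h : ℝ → ℝ, IsAlphaFractal x α (fun t => g.eval t) (fun t => b.eval t) h ∧
        HasBoxDim (graph x h) d ∧ ∀ M, (∀ t ∈ interval x, |g.eval t - b.eval t| ≤ M) →
          ∀ t ∈ interval x, |h t - g.eval t| ≤ A * M := by
  have : Nonempty (Fin N) := ⟨⟨0, by omega⟩⟩
  obtain ⟨i₀, hi₀⟩ := Finite.exists_max fun i => |α i|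
  have ha : |α i₀| < 1 := abs_lt.2 (hα i₀)
  obtain ⟨d, hd⟩ : ∃ d : ℝ, ((∑ i, |α i| ≤ 1) ∧ d = 1) ∨ ((1 < ∑ i, |α i|) ∧
      ∃ s : ℝ, 0 ≤ s ∧ ∑ i, |α i| * ratio x i ^ s = 1 ∧ d = 1 + s) := by
    rcases le_or_gt (∑ i, |α i|) 1 with h | h
    · exact ⟨1, Or.inl ⟨h, rfl⟩⟩
    · obtain ⟨s, hs0, hs⟩ := exists_exponent hN hx hα h
      exact ⟨1 + s, Or.inr ⟨h, s, hs0, hs, rfl⟩⟩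
  refine ⟨d, (1 - |α i₀|)⁻¹, inv_pos.2 (by linarith), fun g b hgb => ?_⟩
  obtain ⟨h, hh, hfe, h0, h1, hM⟩ := exists_fractal_function hN hx ha hi₀ hgb.continuousOn_germ
    hgb.continuousOn_base hgb.left_eq hgb.right_eq
  refine ⟨h, ⟨hgb, hh, isAttractor_graph hN hx hh hfe⟩, ?_, fun M hgM t ht => ?_⟩
  · obtain ⟨Cg, hCg, hg⟩ := exists_lipschitz_eval (x := x) g
    obtain ⟨Cb, hCb, hb⟩ := exists_lipschitz_eval (x := x) b
    have hq : ∀ i, ∀ s ∈ interval x, ∀ t ∈ interval x,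
        |(g.eval (affineMap x i t) - α i * b.eval t) -
          (g.eval (affineMap x i s) - α i * b.eval s)| ≤ (Cg + Cb) * |t - s| := by
      intro i s hs t ht
      have e1 := hg _ (affineMap_mem hN hx i hs) _ (affineMap_mem hN hx i ht)
      rw [affineMap_sub, abs_mul, abs_of_pos (ratio_pos hN hx i)] at e1
      have e2 := hb s hs t ht
      have e3 : ratio x i * |t - s| ≤ |t - s| :=
        mul_le_of_le_one_left (abs_nonneg _) (ratio_lt_one hN hx i).le
      have e4 : |α i| * |b.eval t - b.eval s| ≤ |b.eval t - b.eval s| :=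
        mul_le_of_le_one_left (abs_nonneg _) ((hi₀ i).trans ha.le)
      have e5 := mul_le_mul_of_nonneg_left e3 hCg
      calc |(g.eval (affineMap x i t) - α i * b.eval t) -
            (g.eval (affineMap x i s) - α i * b.eval s)|
          = |(g.eval (affineMap x i t) - g.eval (affineMap x i s)) -
              α i * (b.eval t - b.eval s)| := by ring_nf
        _ ≤ |g.eval (affineMap x i t) - g.eval (affineMap x i s)| +
              |α i| * |b.eval t - b.eval s| := by rw [← abs_mul]; exact abs_sub _ _
        _ ≤ (Cg + Cb) * |t - s| := by linarith
    rcases hd with ⟨hγ, rfl⟩ | ⟨hγ, s, hs0, hs, rfl⟩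
    · exact hasBoxDim_graph_of_sum_le_one hN hx hh (add_nonneg hCg hCb) hfe hq hγ
    · exact hasBoxDim_graph_of_one_lt_sum hN hx hh (add_nonneg hCg hCb) hfe hq hγ hs0 hs
        (exists_hasVariationAtScale hN hx hα hγ hfe h0 h1 hgb.ne)
  · rw [inv_mul_eq_div]
    exact hM M hgM t ht

end Existence

/-! ### The Bernstein operator -/

section Bernstein

variable {N : ℕ} {x : Fin (N + 1) → ℝ}

lemma bernsteinOp_eq (hN : 2 ≤ N) (hx : StrictMono x) (n : ℕ) (f : ℝ → ℝ) (t : ℝ) :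
    bernsteinOp x n f t = ∑ k ∈ Finset.range (n + 1),
      f (x 0 + (k : ℝ) / (n : ℝ) * (x (Fin.last N) - x 0)) *
        (bernsteinPolynomial ℝ n k).eval ((t - x 0) / (x (Fin.last N) - x 0)) := by
  have hℓ := (length_pos hN hx).ne'
  refine Finset.sum_congr rfl fun k hk => ?_
  have hk' : k ≤ n := Nat.lt_succ_iff.1 (Finset.mem_range.1 hk)
  have h1 : 1 - (t - x 0) / (x (Fin.last N) - x 0) =
      (x (Fin.last N) - t) / (x (Fin.last N) - x 0) := by
    rw [eq_div_iff hℓ, sub_mul, div_mul_cancel₀ _ hℓ]; ring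
  simp only [bernsteinPolynomial, Polynomial.eval_mul, Polynomial.eval_natCast,
    Polynomial.eval_pow, Polynomial.eval_X, Polynomial.eval_sub, Polynomial.eval_one]
  rw [h1, div_pow, div_pow]
  have h2 : (x (Fin.last N) - x 0) ^ n =
      (x (Fin.last N) - x 0) ^ k * (x (Fin.last N) - x 0) ^ (n - k) := by
    rw [← pow_add, Nat.add_sub_cancel' hk']
  rw [h2]
  field_simp

lemma exists_bernsteinOp_eq_eval (n : ℕ) (f : ℝ → ℝ) :
    ∃ p : Polynomial ℝ, bernsteinOp x n f = fun t => p.eval t := by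
  refine ⟨∑ k ∈ Finset.range (n + 1),
    Polynomial.C (f (x 0 + (k : ℝ) / (n : ℝ) * (x (Fin.last N) - x 0)) * (n.choose k : ℝ) /
      (x (Fin.last N) - x 0) ^ n) *
      ((Polynomial.X - Polynomial.C (x 0)) ^ k *
        (Polynomial.C (x (Fin.last N)) - Polynomial.X) ^ (n - k)), ?_⟩
  funext t
  simp only [bernsteinOp, Polynomial.eval_finsetSum, Polynomial.eval_mul, Polynomial.eval_C,
    Polynomial.eval_pow, Polynomial.eval_sub, Polynomial.eval_X]
  exact Finset.sum_congr rfl fun k _ => by ring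

lemma node_mem (hN : 2 ≤ N) (hx : StrictMono x) {n k : ℕ} (hk : k ∈ Finset.range (n + 1)) :
    x 0 + (k : ℝ) / (n : ℝ) * (x (Fin.last N) - x 0) ∈ interval x := by
  have hℓ := length_pos hN hx
  have h0 : (0 : ℝ) ≤ (k : ℝ) / n := by positivity
  have h1 : (k : ℝ) / n ≤ 1 :=
    div_le_one_of_le₀ (by exact_mod_cast Nat.lt_succ_iff.1 (Finset.mem_range.1 hk)) (by positivity)
  constructor <;> nlinarith

lemma div_length_mem (hN : 2 ≤ N) (hx : StrictMono x) {t : ℝ} (ht : t ∈ interval x) :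
    (t - x 0) / (x (Fin.last N) - x 0) ∈ unitInterval :=
  ⟨div_nonneg (sub_nonneg.2 ht.1) (length_pos hN hx).le,
    (div_le_one (length_pos hN hx)).2 (sub_le_sub_right ht.2 _)⟩

lemma eval_bernsteinPolynomial_nonneg (n k : ℕ) {s : ℝ} (hs : s ∈ unitInterval) :
    0 ≤ (bernsteinPolynomial ℝ n k).eval s := by
  have h1 := hs.1
  have h2 : 0 ≤ 1 - s := sub_nonneg.2 hs.2
  simp only [bernsteinPolynomial, Polynomial.eval_mul, Polynomial.eval_natCast,
    Polynomial.eval_pow, Polynomial.eval_X, Polynomial.eval_sub, Polynomial.eval_one]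
  positivity

lemma sum_eval_bernsteinPolynomial (n : ℕ) (s : ℝ) :
    ∑ k ∈ Finset.range (n + 1), (bernsteinPolynomial ℝ n k).eval s = 1 := by
  rw [← Polynomial.eval_finsetSum, bernsteinPolynomial.sum, Polynomial.eval_one]

lemma sum_mul_eval_bernsteinPolynomial {n : ℕ} (hn : n ≠ 0) (s : ℝ) :
    ∑ k ∈ Finset.range (n + 1), (k : ℝ) / n * (bernsteinPolynomial ℝ n k).eval s = s := by
  have := congrArg (Polynomial.eval s) (bernsteinPolynomial.sum_smul ℝ n)
  simp only [Polynomial.eval_finsetSum, nsmul_eq_mul, Polynomial.eval_mul,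
    Polynomial.eval_natCast, Polynomial.eval_X] at this
  have hn' : (n : ℝ) ≠ 0 := Nat.cast_ne_zero.2 hn
  simp only [div_mul_eq_mul_div]
  rw [← Finset.sum_div, this, mul_div_cancel_left₀ _ hn']

lemma bernsteinOp_sub (n : ℕ) (f g : ℝ → ℝ) (t : ℝ) :
    bernsteinOp x n (fun t => f t - g t) t = bernsteinOp x n f t - bernsteinOp x n g t := by
  simp only [bernsteinOp]
  rw [← Finset.sum_sub_distrib]
  exact Finset.sum_congr rfl fun k _ => by ring

lemma bernsteinOp_affine (hN : 2 ≤ N) (hx : StrictMono x) {n : ℕ} (hn : n ≠ 0) (m c t : ℝ) :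
    bernsteinOp x n (fun t => m * t + c) t = m * t + c := by
  have hℓ := (length_pos hN hx).ne'
  rw [bernsteinOp_eq hN hx]
  set s := (t - x 0) / (x (Fin.last N) - x 0) with hs
  have : ∀ k : ℕ, (m * (x 0 + (k : ℝ) / n * (x (Fin.last N) - x 0)) + c) *
      (bernsteinPolynomial ℝ n k).eval s =
      (m * x 0 + c) * (bernsteinPolynomial ℝ n k).eval s + m * (x (Fin.last N) - x 0) *
        ((k : ℝ) / n * (bernsteinPolynomial ℝ n k).eval s) := fun k => by ring
  simp only [this]
  rw [Finset.sum_add_distrib, ← Finset.mul_sum, ← Finset.mul_sum, sum_eval_bernsteinPolynomial,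
    sum_mul_eval_bernsteinPolynomial hn, hs]
  field_simp
  ring

lemma abs_bernsteinOp_le (hN : 2 ≤ N) (hx : StrictMono x) (n : ℕ) {f : ℝ → ℝ} {M : ℝ}
    (hM : ∀ t ∈ interval x, |f t| ≤ M) {t : ℝ} (ht : t ∈ interval x) :
    |bernsteinOp x n f t| ≤ M := by
  rw [bernsteinOp_eq hN hx]
  have hs := div_length_mem hN hx ht
  calc _ ≤ ∑ k ∈ Finset.range (n + 1),
        M * (bernsteinPolynomial ℝ n k).eval ((t - x 0) / (x (Fin.last N) - x 0)) := by
        refine (Finset.abs_sum_le_sum_abs _ _).trans (Finset.sum_le_sum fun k hk => ?_)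
        rw [abs_mul, abs_of_nonneg (eval_bernsteinPolynomial_nonneg n k hs)]
        exact mul_le_mul_of_nonneg_right (hM _ (node_mem hN hx hk))
          (eval_bernsteinPolynomial_nonneg n k hs)
    _ = M := by rw [← Finset.mul_sum, sum_eval_bernsteinPolynomial, mul_one]

lemma bernsteinOp_left (hN : 2 ≤ N) (hx : StrictMono x) (n : ℕ) (f : ℝ → ℝ) :
    bernsteinOp x n f (x 0) = f (x 0) := by
  rw [bernsteinOp_eq hN hx]
  simp [bernsteinPolynomial.eval_at_0]

lemma bernsteinOp_right (hN : 2 ≤ N) (hx : StrictMono x) {n : ℕ} (hn : n ≠ 0) (f : ℝ → ℝ) :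
    bernsteinOp x n f (x (Fin.last N)) = f (x (Fin.last N)) := by
  have hn' : (n : ℝ) ≠ 0 := Nat.cast_ne_zero.2 hn
  rw [bernsteinOp_eq hN hx, div_self (length_pos hN hx).ne']
  simp [bernsteinPolynomial.eval_at_1, div_self hn']

/-- A maximum principle: at an interior point, `B_n q` averages the values of `q` at the nodes,
with a positive weight on the end point `x₀`. -/
lemma eq_zero_of_bernsteinOp_eq (hN : 2 ≤ N) (hx : StrictMono x) {n : ℕ} {q : ℝ → ℝ}
    (hq : ContinuousOn q (interval x)) (h0 : q (x 0) = 0) (h1 : q (x (Fin.last N)) = 0)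
    (H : ∀ t ∈ interval x, bernsteinOp x n q t = q t) {t : ℝ} (ht : t ∈ interval x) :
    q t = 0 := by
  have hℓ := length_pos hN hx
  obtain ⟨τ, hτ, hmax⟩ := isCompact_Icc.exists_isMaxOn ⟨_, left_mem_interval hN hx⟩ hq.abs
  have hmax' : ∀ t ∈ interval x, |q t| ≤ |q τ| := fun t ht => hmax ht
  suffices hle : |q τ| ≤ 0 from abs_eq_zero.1 (le_antisymm ((hmax' t ht).trans hle) (abs_nonneg _))
  by_cases hτN : τ = x (Fin.last N)
  · rw [hτN, h1, abs_zero]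
  have hτlt : τ < x (Fin.last N) := lt_of_le_of_ne hτ.2 hτN
  set s := (τ - x 0) / (x (Fin.last N) - x 0) with hs
  have hsI : s ∈ unitInterval := div_length_mem hN hx hτ
  have hs1 : 0 < 1 - s := by
    rw [hs, sub_pos, div_lt_one hℓ]; linarith
  have hw : (bernsteinPolynomial ℝ n 0).eval s = (1 - s) ^ n := by
    simp [bernsteinPolynomial]
  have key : |q τ| ≤ (1 - (1 - s) ^ n) * |q τ| := by
    have hsum := sum_eval_bernsteinPolynomial n s
    rw [Finset.sum_range_succ', hw] at hsum
    calc |q τ| = |bernsteinOp x n q τ| := by rw [H τ hτ]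
      _ = |∑ k ∈ Finset.range n,
            q (x 0 + ((k + 1 : ℕ) : ℝ) / (n : ℝ) * (x (Fin.last N) - x 0)) *
              (bernsteinPolynomial ℝ n (k + 1)).eval s| := by
          rw [bernsteinOp_eq hN hx, Finset.sum_range_succ']
          simp [h0, hs]
      _ ≤ ∑ k ∈ Finset.range n, |q τ| * (bernsteinPolynomial ℝ n (k + 1)).eval s := by
          refine (Finset.abs_sum_le_sum_abs _ _).trans (Finset.sum_le_sum fun k hk => ?_)
          rw [abs_mul, abs_of_nonneg (eval_bernsteinPolynomial_nonneg n _ hsI)]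
          exact mul_le_mul_of_nonneg_right (hmax' _ (node_mem hN hx (by simpa using hk)))
            (eval_bernsteinPolynomial_nonneg n _ hsI)
      _ = (1 - (1 - s) ^ n) * |q τ| := by
          rw [← Finset.mul_sum, mul_comm]
          congr 1
          linarith
  have hpos : 0 < (1 - s) ^ n := pow_pos hs1 n
  nlinarith

/-- The affine function with the same values as `f` at the end points of the interval. -/
noncomputable def chord {N : ℕ} (x : Fin (N + 1) → ℝ) (f : ℝ → ℝ) (t : ℝ) : ℝ :=
  (f (x (Fin.last N)) - f (x 0)) / (x (Fin.last N) - x 0) * t +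
    (f (x 0) - (f (x (Fin.last N)) - f (x 0)) / (x (Fin.last N) - x 0) * x 0)

lemma eq_chord_of_bernsteinOp_eq (hN : 2 ≤ N) (hx : StrictMono x) {n : ℕ} (hn : n ≠ 0)
    {p : ℝ → ℝ} (hp : ContinuousOn p (interval x))
    (H : ∀ t ∈ interval x, bernsteinOp x n p t = p t) {t : ℝ} (ht : t ∈ interval x) :
    p t = chord x p t := by
  have hℓ := (length_pos hN hx).ne'
  refine sub_eq_zero.1 (eq_zero_of_bernsteinOp_eq hN hx (n := n) (q := fun t => p t - chord x p t)
    ?_ ?_ ?_ ?_ ht)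
  · refine hp.sub (Continuous.continuousOn ?_)
    unfold chord
    fun_prop
  · simp [chord]
  · simp only [chord]
    field_simp
    ring
  · intro t ht
    rw [bernsteinOp_sub, H t ht]
    congr 1
    exact bernsteinOp_affine hN hx hn _ _ t

lemma bernsteinOp_tendsto (hN : 2 ≤ N) (hx : StrictMono x) {f : ℝ → ℝ}
    (hf : ContinuousOn f (interval x)) {ε : ℝ} (hε : 0 < ε) :
    ∀ᶠ n in atTop, ∀ t ∈ interval x, |bernsteinOp x n f t - f t| < ε := by
  have hℓ := length_pos hN hx
  have hmaps : ∀ s : unitInterval, x 0 + s * (x (Fin.last N) - x 0) ∈ interval x := by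
    intro s
    have h1 := s.2.1
    have h2 := s.2.2
    constructor <;> nlinarith
  let F : C(unitInterval, ℝ) := ⟨fun s => f (x 0 + s * (x (Fin.last N) - x 0)),
    hf.comp_continuous (by fun_prop) hmaps⟩
  have := Metric.tendsto_nhds.1 (bernsteinApproximation_uniform F) ε hε
  filter_upwards [this] with n hn t ht
  have hs := div_length_mem hN hx ht
  have h1 := (ContinuousMap.dist_lt_iff hε).1 hn ⟨_, hs⟩
  rw [Real.dist_eq, bernsteinApproximation.apply] at h1
  have h2 : F ⟨_, hs⟩ = f t := by
    change f (x 0 + (t - x 0) / (x (Fin.last N) - x 0) * (x (Fin.last N) - x 0)) = f t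
    rw [div_mul_cancel₀ _ hℓ.ne', add_sub_cancel]
  have h3 : ∑ k : Fin (n + 1), bernstein n k ⟨_, hs⟩ • F (bernstein.z k) =
      bernsteinOp x n f t := by
    rw [bernsteinOp_eq hN hx, Finset.sum_range]
    refine Finset.sum_congr rfl fun k _ => ?_
    rw [smul_eq_mul, mul_comm]
    rfl
  rwa [h2, h3] at h1

end Bernstein

/-! ### Approximation by fractal functions of equal box dimension -/

section Approximation

variable {N : ℕ} {x : Fin (N + 1) → ℝ}

/-- Admissible polynomial germs and bases that both converge uniformly to `f` give fractal
functions converging uniformly to `f`, with graphs of the same box dimension. -/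
lemma exists_alphaFractal_tendsto (hN : 2 ≤ N) (hx : StrictMono x) {α : Fin N → ℝ}
    (hα : ∀ i, α i ∈ Ioo (-1 : ℝ) 1) {f : ℝ → ℝ} {g b : ℕ → ℝ → ℝ}
    (hg : ∀ k, ∃ p : Polynomial ℝ, g k = fun t => p.eval t)
    (hb : ∀ k, ∃ p : Polynomial ℝ, b k = fun t => p.eval t)
    (hgb : ∀ k, IsAdmissible x (g k) (b k))
    (hlim : ∀ ε : ℝ, 0 < ε → ∀ᶠ k in atTop, ∀ t ∈ interval x, |g k t - f t| ≤ ε)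
    (hdist : ∀ ε : ℝ, 0 < ε → ∀ᶠ k in atTop, ∀ t ∈ interval x, |g k t - b k t| ≤ ε) :
    ∃ (h : ℕ → ℝ → ℝ) (d : ℝ), (∀ k, IsAlphaFractal x α (g k) (b k) (h k)) ∧
      (∀ k, HasBoxDim (graph x (h k)) d) ∧ TendstoUniformlyOn h f atTop (interval x) := by
  obtain ⟨d, A, hA, H⟩ := exists_alphaFractal_hasBoxDim hN hx hα
  have H' : ∀ k, ∃ h : ℝ → ℝ, IsAlphaFractal x α (g k) (b k) h ∧ HasBoxDim (graph x h) d ∧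
      ∀ M, (∀ t ∈ interval x, |g k t - b k t| ≤ M) →
        ∀ t ∈ interval x, |h t - g k t| ≤ A * M := by
    intro k
    obtain ⟨p, hp⟩ := hg k
    obtain ⟨r, hr⟩ := hb k
    have := hgb k
    rw [hp, hr] at this ⊢
    exact H p r this
  choose h h1 h2 h3 using H'
  refine ⟨h, d, h1, h2, Metric.tendstoUniformlyOn_iff.2 fun ε hε => ?_⟩
  filter_upwards [hlim (ε / 4) (by positivity), hdist (ε / (4 * A)) (by positivity)]
    with k hk1 hk2 t ht
  have e1 := hk1 t ht
  have e2 := h3 k _ hk2 t ht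
  have e3 : A * (ε / (4 * A)) = ε / 4 := by field_simp
  rw [e3] at e2
  rw [dist_comm, Real.dist_eq]
  calc |h k t - f t| ≤ |h k t - g k t| + |g k t - f t| := abs_sub_le _ _ _
    _ < ε := by linarith

/-- For an affine function the germs are parabolas through the end points of its graph. -/
lemma exists_approximation_of_affine (hN : 2 ≤ N) (hx : StrictMono x) {f : ℝ → ℝ}
    (hf : IsAffineOnInterval x f) :
    ∃ g b : ℕ → ℝ → ℝ, (∀ k, ∃ p : Polynomial ℝ, g k = fun t => p.eval t) ∧
      (∀ k, ∃ p : Polynomial ℝ, b k = fun t => p.eval t) ∧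
      (∀ k, IsAdmissible x (g k) (b k)) ∧
      (∀ ε : ℝ, 0 < ε → ∀ᶠ k in atTop, ∀ t ∈ interval x, |g k t - f t| ≤ ε) ∧
      ∀ ε : ℝ, 0 < ε → ∀ᶠ k in atTop, ∀ t ∈ interval x, |g k t - b k t| ≤ ε := by
  obtain ⟨m, c, hmc⟩ := hf
  have hℓ := length_pos hN hx
  set ℓ := x (Fin.last N) - x 0 with hℓdef
  have hsmall : ∀ ε : ℝ, 0 < ε → ∀ᶠ k : ℕ in atTop, ∀ t ∈ interval x,
      |(t - x 0) * (x (Fin.last N) - t) / ((k : ℝ) + 1)| ≤ ε := by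
    intro ε hε
    have hlim : Tendsto (fun k : ℕ => ℓ * ℓ * (1 / ((k : ℝ) + 1))) atTop (𝓝 0) := by
      simpa using tendsto_one_div_add_atTop_nhds_zero_nat.const_mul (ℓ * ℓ)
    filter_upwards [hlim.eventually (gt_mem_nhds hε)] with k hk t ht
    have a1 : 0 ≤ t - x 0 := sub_nonneg.2 ht.1
    have a2 : 0 ≤ x (Fin.last N) - t := sub_nonneg.2 ht.2
    rw [abs_of_nonneg (by positivity), div_eq_mul_one_div]
    refine le_trans ?_ hk.le
    gcongr
    · linarith [ht.2]
    · linarith [ht.1]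
  refine ⟨fun k t => m * t + c + (t - x 0) * (x (Fin.last N) - t) / ((k : ℝ) + 1),
    fun _ t => m * t + c, fun k => ⟨Polynomial.C m * Polynomial.X + Polynomial.C c +
      (Polynomial.X - Polynomial.C (x 0)) * (Polynomial.C (x (Fin.last N)) - Polynomial.X) *
        Polynomial.C (((k : ℝ) + 1)⁻¹), ?_⟩,
    fun _ => ⟨Polynomial.C m * Polynomial.X + Polynomial.C c, ?_⟩, fun k => ?_, ?_, ?_⟩
  · funext t
    simp [div_eq_mul_inv]
  · funext t
    simp
  · refine ⟨Continuous.continuousOn (by fun_prop), Continuous.continuousOn (by fun_prop),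
      by simp, by simp, fun H => ?_⟩
    have hmid : (x 0 + x (Fin.last N)) / 2 ∈ interval x := by constructor <;> linarith
    have := H hmid
    have hpos : 0 < ((x 0 + x (Fin.last N)) / 2 - x 0) *
        (x (Fin.last N) - (x 0 + x (Fin.last N)) / 2) / ((k : ℝ) + 1) :=
      div_pos (mul_pos (by linarith) (by linarith)) (by positivity)
    simp only at this
    linarith
  · intro ε hε
    filter_upwards [hsmall ε hε] with k hk t ht
    rw [hmc t ht, add_sub_cancel_left]
    exact hk t ht
  · intro ε hε
    filter_upwards [hsmall ε hε] with k hk t ht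
    rw [add_sub_cancel_left]
    exact hk t ht

/-- If `f` is not affine then `B_n f` is eventually not a fixed point of `B_n`: the fixed points
are affine, and `B_n f` has the same chord as `f`. -/
lemma exists_isAdmissible_bernsteinOp (hN : 2 ≤ N) (hx : StrictMono x) {f : ℝ → ℝ}
    (hf : ContinuousOn f (interval x)) (hna : ¬ IsAffineOnInterval x f) :
    ∃ n₀ : ℕ, 1 ≤ n₀ ∧ ∀ n, n₀ ≤ n →
      IsAdmissible x (bernsteinOp x n f) (bernsteinOp x n (bernsteinOp x n f)) := by
  obtain ⟨τ, hτ, hne⟩ : ∃ τ ∈ interval x, f τ ≠ chord x f τ := by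
    by_contra! H
    exact hna ⟨_, _, H⟩
  have hev := bernsteinOp_tendsto hN hx hf (abs_pos.2 (sub_ne_zero.2 hne))
  obtain ⟨n₁, hn₁⟩ := eventually_atTop.1 hev
  have hcont : ∀ n (f : ℝ → ℝ), ContinuousOn (bernsteinOp x n f) (interval x) := by
    intro n f
    obtain ⟨p, hp⟩ := exists_bernsteinOp_eq_eval (x := x) n f
    rw [hp]
    exact p.continuous.continuousOn
  refine ⟨max 1 n₁, le_max_left _ _, fun n hn => ?_⟩
  have hn0 : n ≠ 0 := by have := (le_max_left 1 n₁).trans hn; omega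
  refine ⟨hcont _ _, hcont _ _, bernsteinOp_left hN hx _ _, bernsteinOp_right hN hx hn0 _,
    fun H => ?_⟩
  have h1 := eq_chord_of_bernsteinOp_eq hN hx hn0 (hcont n f) H hτ
  have h2 : chord x (bernsteinOp x n f) τ = chord x f τ := by
    simp only [chord, bernsteinOp_left hN hx, bernsteinOp_right hN hx hn0]
  have h3 := hn₁ n ((le_max_right _ _).trans hn) τ hτ
  rw [h1, h2, abs_sub_comm] at h3
  exact lt_irrefl _ h3

end Approximation

end AlphaFractal

theorem mainTheorem10 (N : ℕ) (hN : 2 ≤ N) (x : Fin (N + 1) → ℝ) (hx : StrictMono x)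
    (α : Fin N → ℝ) (hα : ∀ i, α i ∈ Ioo (-1 : ℝ) 1)
    (f : ℝ → ℝ) (hf : ContinuousOn f (AlphaFractal.interval x)) :
    ∃ (g b h : ℕ → ℝ → ℝ) (d : ℝ),
      (∀ k, AlphaFractal.IsAlphaFractal x α (g k) (b k) (h k)) ∧
      (∀ k, AlphaFractal.HasBoxDim (AlphaFractal.graph x (h k)) d) ∧
      TendstoUniformlyOn h f atTop (AlphaFractal.interval x) ∧
      (¬ AlphaFractal.IsAffineOnInterval x f →
        ∃ n₀ : ℕ, 1 ≤ n₀ ∧ ∀ k,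
          g k = AlphaFractal.bernsteinOp x (n₀ + k) f ∧
          b k = AlphaFractal.bernsteinOp x (n₀ + k) (g k)) := by
  by_cases haff : AlphaFractal.IsAffineOnInterval x f
  · obtain ⟨g, b, hg, hb, hgb, hlim, hdist⟩ :=
      AlphaFractal.exists_approximation_of_affine hN hx haff
    obtain ⟨h, d, h1, h2, h3⟩ :=
      AlphaFractal.exists_alphaFractal_tendsto hN hx hα hg hb hgb hlim hdist
    exact ⟨g, b, h, d, h1, h2, h3, fun hna => absurd haff hna⟩
  · obtain ⟨n₀, hn₀, hadm⟩ := AlphaFractal.exists_isAdmissible_bernsteinOp hN hx hf haff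
    have hev : ∀ ε : ℝ, 0 < ε → ∀ᶠ k in atTop, ∀ t ∈ AlphaFractal.interval x,
        |AlphaFractal.bernsteinOp x (n₀ + k) f t - f t| ≤ ε := by
      intro ε hε
      obtain ⟨n₁, hn₁⟩ := eventually_atTop.1 (AlphaFractal.bernsteinOp_tendsto hN hx hf hε)
      filter_upwards [eventually_ge_atTop n₁] with k hk t ht
      exact (hn₁ (n₀ + k) (by omega) t ht).le
    obtain ⟨h, d, h1, h2, h3⟩ := AlphaFractal.exists_alphaFractal_tendsto hN hx hα (f := f)
      (g := fun k => AlphaFractal.bernsteinOp x (n₀ + k) f)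
      (b := fun k => AlphaFractal.bernsteinOp x (n₀ + k) (AlphaFractal.bernsteinOp x (n₀ + k) f))
      (fun k => AlphaFractal.exists_bernsteinOp_eq_eval _ _)
      (fun k => AlphaFractal.exists_bernsteinOp_eq_eval _ _)
      (fun k => hadm _ (Nat.le_add_right _ _)) hev (fun ε hε => by
        -- `B_n f - B_n (B_n f) = B_n (f - B_n f)`, and `B_n` does not increase the sup norm.
        filter_upwards [hev ε hε] with k hk t ht
        rw [← AlphaFractal.bernsteinOp_sub]
        exact AlphaFractal.abs_bernsteinOp_le hN hx _
          (fun t ht => by rw [abs_sub_comm]; exact hk t ht) ht)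
    exact ⟨_, _, h, d, h1, h2, h3, fun _ => ⟨n₀, hn₀, fun k => ⟨rfl, rfl⟩⟩⟩
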